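/- Let $p$ be a prime, $n\ge 1$ an integer, and let $\mathbb{Q}_p^n$ carry the norm $|x|_p=\max_j|x_j|_p$ and the Haar measure $dx$ with $|E|_h=\int_E dx$, normalized so that $|B_0(0)|_h=1$, where $B_\gamma(x)=\{y\in\mathbb{Q}_p^n:|y-x|_p\le p^\gamma\}$ for $\gamma\in\mathbb{Z}$. For a locally integrable $b:\mathbb{Q}_p^n\to\mathbb{R}$ put $b_B=|B|_h^{-1}\int_B b\,dx$ for a ball $B$ and $$\mathcal{M}_b^p(f)(x)=\sup_{\gamma\in\mathbb{Z}}\frac{1}{|B_\gamma(x)|_h}\int_{B_\gamma(x)}|b(x)-b(y)|\,|f(y)|\,dy .$$ For $\beta\in(0,1)$, $\Lambda_\beta(\mathbb{Q}_p^n)$ is the set of measurable functions that agree almost everywhere with a measurable function $f$ such that $\sup_{x\ne y}|f(x)-f(y)|/|x-y|_p^\beta<\infty$. For measurable $q(\cdot)$ let $q_-(E)$ and $q_+(E)$ be its essential infimum and supremum over $E$, and $q_\pm=q_\pm(\mathbb{Q}_p^n)$. Let $\mathscr{P}(\mathbb{Q}_p^n)$ be the set of measurable $q(\cdot):\mathbb{Q}_p^n\to(1,\infty)$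 with $1<q_-\le q(x)\le q_+<\infty$ for all $x$, and let $\mathscr{C}^{\log}(\mathbb{Q}_p^n)$ be the set of $q(\cdot)\in\mathscr{P}(\mathbb{Q}_p^n)$ for which there is a constant $C$ with $\gamma\,\big(q_-(B_\gamma(x))-q_+(B_\gamma(x))\big)\le C$ for all $\gamma\in\mathbb{Z}$, $x\in\mathbb{Q}_p^n$, and $|q(x)-q(y)|\le C/\log_p(p+\min\{|x|_p,|y|_p\})$ for all $x,y\in\mathbb{Q}_p^n$. For $q(\cdot)\in\mathscr{P}(\mathbb{Q}_p^n)$, $L^{q(\cdot)}(\mathbb{Q}_p^n)$ is the space of measurable $f$ with $\int(|f(x)|/\eta)^{q(x)}dx<\infty$ for some $\eta>0$, with the norm $\|f\|_{L^{q(\cdot)}}=\inf\{\eta>0:\int(|f(x)|/\eta)^{q(x)}dx\le1\}$. An operator $T$ is bounded from $L^{r(\cdot)}(\mathbb{Q}_p^n)$ to $L^{q(\cdot)}(\mathbb{Q}_p^n)$ if there is a constant $C$ such that $Tf\in L^{q(\cdot)}(\mathbb{Q}_p^n)$ and $\|Tf\|_{L^{q(\cdot)}}\le C\|f\|_{L^{r(\cdot)}}$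 for all $f\in L^{r(\cdot)}(\mathbb{Q}_p^n)$. Let $0<\beta<1$ and let $b$ be a locally integrable function on $\mathbb{Q}_p^n$. Call $(r(\cdot),q(\cdot))$ admissible if $r(\cdot),q(\cdot)\in\mathscr{C}^{\log}(\mathbb{Q}_p^n)$, $r_+<n/\beta$ and $1/q(\cdot)=1/r(\cdot)-\beta/n$. Then the following statements are equivalent: 1. $b\in\Lambda_\beta(\mathbb{Q}_p^n)$. 2. $\mathcal{M}_b^p$ is bounded from $L^{r(\cdot)}(\mathbb{Q}_p^n)$ to $L^{q(\cdot)}(\mathbb{Q}_p^n)$ for all admissible $(r(\cdot),q(\cdot))$. 3. $\mathcal{M}_b^p$ is bounded from $L^{r(\cdot)}(\mathbb{Q}_p^n)$ to $L^{q(\cdot)}(\mathbb{Q}_p^n)$ for some admissible $(r(\cdot),q(\cdot))$. 4. For some admissible $(r(\cdot),q(\cdot))$, $$\sup_{\gamma\in\mathbb{Z},\,x\in\mathbb{Q}_p^n}\frac{1}{|B_\gamma(x)|_h^{\beta/n}}\,\frac{\big\|(b-b_{B_\gamma(x)})\chi_{B_\gamma(x)}\big\|_{L^{q(\cdot)}}}{\|\chi_{B_\gamma(x)}\|_{L^{q(\cdot)}}}<\infty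 .\tag{$*$}$$ 5. $(*)$ holds for all admissible $(r(\cdot),q(\cdot))$. -/

import Mathlib

open MeasureTheory
open scoped ENNReal NNReal

namespace PadicVar

noncomputable section

/-- The Borel `σ`-algebra on `ℚ_p`. -/
instance instMeasurableSpacePadic (p : ℕ) [Fact p.Prime] : MeasurableSpace ℚ_[p] := borel _

instance instBorelSpacePadic (p : ℕ) [Fact p.Prime] : BorelSpace ℚ_[p] := ⟨rfl⟩

/-- The vector space `ℚ_p^n`. Its norm is the maximum norm `|x|_p = max_j |x_j|_p`. -/
abbrev Qpn (p n : ℕ) [Fact p.Prime] : Type := Fin n → ℚ_[p]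

/-- The closed unit ball `B_0(0)` of `ℚ_p^n`, a compact set with non-empty interior. -/
def unitBall (p n : ℕ) [Fact p.Prime] : TopologicalSpace.PositiveCompacts (Qpn p n) where
  carrier := Metric.closedBall 0 1
  isCompact' := isCompact_closedBall 0 1
  interior_nonempty' :=
    ⟨0, Metric.ball_subset_interior_closedBall (Metric.mem_ball_self one_pos)⟩

/-- The Haar measure of `ℚ_p^n`, normalized so that the closed unit ball has measure `1`. -/
def haar (p n : ℕ) [Fact p.Prime] : Measure (Qpn p n) :=
  Measure.addHaarMeasure (unitBall p n)

variable {p n : ℕ} [Fact p.Prime]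

/-- The ball `B_γ(a) = {x : |x - a|_p ≤ p ^ γ}`. -/
def pBall (γ : ℤ) (a : Qpn p n) : Set (Qpn p n) := Metric.closedBall a ((p : ℝ) ^ γ)

/-- The class `𝒫(ℚ_p^n)`: measurable exponents with `1 < q₋ ≤ q(x) ≤ q₊ < ∞` for all `x`, where
`q₋` and `q₊` are the essential infimum and the essential supremum. -/
structure IsExponent (q : Qpn p n → ℝ) : Prop where
  measurable : Measurable q
  bddAbove : BddAbove (Set.range q)
  one_lt_essInf : 1 < essInf q (haar p n)
  essInf_le : ∀ x, essInf q (haar p n) ≤ q x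
  le_essSup : ∀ x, q x ≤ essSup q (haar p n)

/-- The class `𝒞^log(ℚ_p^n)` of globally log-Hölder continuous exponents in `𝒫(ℚ_p^n)`. -/
structure IsLogHolder (q : Qpn p n → ℝ) : Prop where
  isExponent : IsExponent q
  local_cond : ∃ C : ℝ, ∀ (γ : ℤ) (x : Qpn p n),
    (γ : ℝ) * (essInf q ((haar p n).restrict (pBall γ x)) -
      essSup q ((haar p n).restrict (pBall γ x))) ≤ C
  infinity_cond : ∃ C : ℝ, ∀ x y : Qpn p n,
    |q x - q y| ≤ C / Real.logb p (p + min ‖x‖ ‖y‖)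

section Lebesgue

variable {ε : Type*} [TopologicalSpace ε] [ContinuousENorm ε]

/-- The modular of `f / η`, that is `∫ (|f(x)| / η) ^ q(x) dx`. -/
def modular (q : Qpn p n → ℝ) (f : Qpn p n → ε) (η : ℝ≥0) : ℝ≥0∞ :=
  ∫⁻ x, (‖f x‖ₑ / (η : ℝ≥0∞)) ^ (q x) ∂(haar p n)

/-- The Luxemburg norm on `L^{q(·)}(ℚ_p^n)`; it is `∞` where the infimum is over the empty set. -/
def luxNorm (q : Qpn p n → ℝ) (f : Qpn p n → ε) : ℝ≥0∞ :=
  ⨅ η ∈ {η : ℝ≥0 | 0 < η ∧ modular q f η ≤ 1}, (η : ℝ≥0∞)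

/-- Membership in the variable exponent Lebesgue space `L^{q(·)}(ℚ_p^n)`. For functions with
values in `[0, ∞]` it forces the function to be finite almost everywhere. -/
def MemLvar (q : Qpn p n → ℝ) (f : Qpn p n → ε) : Prop :=
  AEStronglyMeasurable f (haar p n) ∧ ∃ η : ℝ≥0, 0 < η ∧ modular q f η < ∞

end Lebesgue

/-- The maximal commutator `M_b^p (f)(x)`, the supremum over `γ ∈ ℤ` of the averages of
`|b(x) - b(y)| |f(y)|` over `B_γ(x)`, with values in `[0, ∞]`. -/
def maximalCommutator (b f : Qpn p n → ℝ) (x : Qpn p n) : ℝ≥0∞ :=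
  ⨆ γ : ℤ, (haar p n (pBall γ x))⁻¹ *
    ∫⁻ y in pBall γ x, ‖b x - b y‖ₑ * ‖f y‖ₑ ∂(haar p n)

/-- `M_b^p` is bounded from `L^{r(·)}(ℚ_p^n)` to `L^{q(·)}(ℚ_p^n)`. -/
def CommutatorBounded (b r q : Qpn p n → ℝ) : Prop :=
  ∃ C : ℝ≥0, ∀ f : Qpn p n → ℝ, MemLvar r f →
    MemLvar q (maximalCommutator b f) ∧ luxNorm q (maximalCommutator b f) ≤ C * luxNorm r f

/-- The exponents `r(·), q(·) ∈ 𝒞^log` with `r(·) ∈ 𝒫`, `r₊ < n / β` and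
`1 / q(·) = 1 / r(·) - β / n`. -/
structure AdmissiblePair (β : ℝ) (r q : Qpn p n → ℝ) : Prop where
  logHolder_r : IsLogHolder r
  logHolder_q : IsLogHolder q
  essSup_lt : essSup r (haar p n) < n / β
  one_div_eq : ∀ x, 1 / q x = 1 / r x - β / n

/-- The quantity
`sup_{γ, x} |B_γ(x)|^{-β/n} ‖(b - b_{B_γ(x)}) χ_{B_γ(x)}‖_{q(·)} / ‖χ_{B_γ(x)}‖_{q(·)}`. -/
def oscillation (β : ℝ) (b q : Qpn p n → ℝ) : ℝ≥0∞ :=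
  ⨆ (γ : ℤ) (x : Qpn p n), ((haar p n (pBall γ x)) ^ (β / n))⁻¹ *
    (luxNorm q ((pBall γ x).indicator fun y => b y - ⨍ z in pBall γ x, b z ∂(haar p n)) /
      luxNorm q ((pBall γ x).indicator fun _ => (1 : ℝ)))

/-- The homogeneous Lipschitz seminorm `sup_{x ≠ y} |f(x) - f(y)| / |x - y|_p ^ β`. -/
def lipNorm (β : ℝ) (f : Qpn p n → ℝ) : ℝ≥0∞ :=
  ⨆ (x : Qpn p n) (y : Qpn p n) (_ : x ≠ y), ‖f x - f y‖ₑ / ‖x - y‖ₑ ^ β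

/-- `b ∈ Λ_β(ℚ_p^n)`. Locally integrable functions are identified when they agree almost
everywhere, so the requirement is that some representative of `b` has finite seminorm. -/
def MemLipschitz (β : ℝ) (b : Qpn p n → ℝ) : Prop :=
  ∃ f : Qpn p n → ℝ, Measurable f ∧ f =ᵐ[haar p n] b ∧ lipNorm β f < ∞

end

end PadicVar

namespace PadicVar

open Metric Set Filter Topology

variable {p n : ℕ} [Fact p.Prime]

/-! The implications run 1 → 2 → 3 → 4 → 1 and 1 → 5 → 4; the passages from "all" to "some" only
need one admissible pair, and constant exponents give it (`exists_admissiblePair`).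

From 1 to 2: for a Lipschitz representative, |b(x) - b(y)| is at most a constant times p^(γβ) on
B_γ(x), so the commutator is dominated almost everywhere by a fractional maximal function
(`maximalCommutator_le`). Its boundedness is the analytic core,
`exists_lintegral_fractionalMaximal_rpow_le`. The function is split at height one. In Jensen's
inequality on a ball the variable exponent r is replaced by a number: its essential infimum over the
ball for the large part, its value at infinity for the small part. Log-Hölder continuity makes this
cost a constant factor and, for the small part, an integrable error. A Hedberg-type argument then
bounds the fractional maximal function to the power q(x) by a Hardy–Littlewood maximal function to
the constant power s = r₋ > 1, plus such an error, and the maximal theorem applies.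

From 3 to 4: on a ball B the commutator of χ_B dominates |b - b_B|. The norms of χ_B in L^r and L^q
are comparable to |B|^(1/r₀) and |B|^(1/q₀) for reference exponents with 1/r₀ = β/n + 1/q₀, which
produces the factor |B|^(β/n).

From 4 to 1: Hölder's inequality against χ_B turns the variable exponent oscillation into a mean
oscillation of size p^(γβ). By Campanato's argument (`memLipschitz_of_ballAverage_le`) the averages
over shrinking balls converge geometrically to a Lipschitz function, equal to b almost everywhere by
Lebesgue differentiation. From 1 to 5 the bound on |b - b_B| is pointwise. -/

instance : (haar p n).IsAddHaarMeasure := by unfold haar; infer_instance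

lemma one_lt_prime_real (p : ℕ) [Fact p.Prime] : (1 : ℝ) < p := by
  exact_mod_cast (Fact.out : p.Prime).one_lt

lemma prime_real_pos (p : ℕ) [Fact p.Prime] : (0 : ℝ) < p :=
  one_pos.trans (one_lt_prime_real p)

lemma one_le_prime_ennreal (p : ℕ) [Fact p.Prime] : (1 : ℝ≥0∞) ≤ p := by
  exact_mod_cast (Fact.out : p.Prime).one_lt.le

lemma prime_ennreal_ne_zero (p : ℕ) [Fact p.Prime] : (p : ℝ≥0∞) ≠ 0 := by
  exact_mod_cast (Fact.out : p.Prime).ne_zero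

lemma prime_ennreal_ne_top (p : ℕ) : (p : ℝ≥0∞) ≠ ∞ := ENNReal.natCast_ne_top p

/-! ### Balls of ℚ_p^n and their Haar measure -/

lemma mem_pBall {γ : ℤ} {a x : Qpn p n} : x ∈ pBall γ a ↔ ‖x - a‖ ≤ (p : ℝ) ^ γ := by
  rw [pBall, mem_closedBall, dist_eq_norm]

lemma self_mem_pBall (γ : ℤ) (x : Qpn p n) : x ∈ pBall γ x := by
  rw [mem_pBall, sub_self, norm_zero]
  exact zpow_nonneg (prime_real_pos p).le _

lemma measurableSet_pBall (γ : ℤ) (a : Qpn p n) : MeasurableSet (pBall γ a) :=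
  isClosed_closedBall.measurableSet

lemma pBall_eq_of_mem {γ : ℤ} {a x : Qpn p n} (h : x ∈ pBall γ a) : pBall γ x = pBall γ a :=
  (IsUltrametricDist.closedBall_eq_of_mem h).symm

lemma pBall_mono {γ δ : ℤ} (h : γ ≤ δ) (a : Qpn p n) : pBall γ a ⊆ pBall δ a :=
  closedBall_subset_closedBall (zpow_le_zpow_right₀ (one_lt_prime_real p).le h)

lemma exists_digit {x : ℚ_[p]} (hx : ‖x‖ ≤ 1) : ∃ d : Fin p, ‖x - (d : ℕ)‖ < 1 := by
  let z : ℤ_[p] := ⟨x, hx⟩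
  refine ⟨⟨z.zmodRepr, z.zmodRepr_lt_p⟩, ?_⟩
  have := z.norm_sub_zmodRepr_lt_one
  rw [PadicInt.norm_def] at this
  exact this

lemma digit_unique {d e : Fin p} (h : ‖((d : ℕ) : ℚ_[p]) - (e : ℕ)‖ < 1) : d = e := by
  have h2 : ‖((((d : ℕ) : ℤ) - ((e : ℕ) : ℤ) : ℤ) : ℚ_[p])‖ < 1 := by
    push_cast; exact h
  rw [Padic.norm_intCast_lt_one_iff] at h2
  obtain ⟨k, hk⟩ := h2
  have hd := d.2
  have he := e.2
  have hp : (0 : ℤ) < p := by exact_mod_cast (Fact.out : p.Prime).pos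
  have hk0 : k = 0 := by
    by_contra hne
    rcases lt_or_gt_of_ne hne with h | h
    · nlinarith
    · nlinarith
  subst hk0
  ext
  omega

lemma norm_le_zpow_iff_scaled {γ : ℤ} {x : ℚ_[p]} :
    ‖x‖ ≤ (p : ℝ) ^ γ ↔ ‖(p : ℚ_[p]) ^ γ * x‖ ≤ 1 := by
  rw [norm_mul, Padic.norm_p_zpow, zpow_neg, inv_mul_le_iff₀ (zpow_pos (prime_real_pos p) _),
    mul_one]

lemma haar_pBall_center (γ : ℤ) (a : Qpn p n) :
    haar p n (pBall γ a) = haar p n (pBall γ 0) := by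
  rw [← measure_preimage_add (haar p n) (-a) (pBall γ 0)]
  congr 1
  ext y
  simp [mem_pBall, sub_eq_neg_add]

/-- The larger ball is the disjoint union of p^n translates of the smaller one, centred at
p^(-(γ+1)) d for the vectors d of p-adic digits. -/
lemma haar_pBall_zero_succ (γ : ℤ) :
    haar p n (pBall (γ + 1) 0) = (p : ℝ≥0∞) ^ n * haar p n (pBall γ 0) := by
  have hp0 : (p : ℚ_[p]) ≠ 0 := by exact_mod_cast (Fact.out : p.Prime).ne_zero
  let c : (Fin n → Fin p) → Qpn p n := fun d i => (p : ℚ_[p]) ^ (-(γ + 1)) * ((d i : ℕ) : ℚ_[p])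
  -- The norm takes no value strictly between p^γ and p^(γ+1), so the closed condition at scale γ is
  -- an open one at scale γ + 1, that is, congruence to a digit after rescaling.
  have hscale : ∀ (y : ℚ_[p]) (k : ℕ), ‖y - (p : ℚ_[p]) ^ (-(γ + 1)) * k‖ ≤ (p : ℝ) ^ γ ↔
      ‖(p : ℚ_[p]) ^ (γ + 1) * y - k‖ < 1 := by
    intro y k
    have h1 := Padic.norm_le_pow_iff_norm_lt_pow_add_one
      (p := p) (y - (p : ℚ_[p]) ^ (-(γ + 1)) * k) γ
    rw [h1]
    have h2 : (p : ℚ_[p]) ^ (γ + 1) * y - k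
        = (p : ℚ_[p]) ^ (γ + 1) * (y - (p : ℚ_[p]) ^ (-(γ + 1)) * k) := by
      rw [mul_sub, ← mul_assoc, ← zpow_add₀ hp0]; simp
    rw [h2, norm_mul, Padic.norm_p_zpow, zpow_neg (p : ℝ),
      inv_mul_lt_iff₀ (zpow_pos (prime_real_pos p) _), mul_one]
  have hmem : ∀ d (y : Qpn p n), y ∈ pBall γ (c d) ↔
      ∀ i, ‖(p : ℚ_[p]) ^ (γ + 1) * y i - ((d i : ℕ) : ℚ_[p])‖ < 1 := by
    intro d y
    rw [mem_pBall, pi_norm_le_iff_of_nonneg (zpow_nonneg (prime_real_pos p).le _)]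
    exact forall_congr' fun i => hscale (y i) _
  have hU : pBall (γ + 1) (0 : Qpn p n) = ⋃ d, pBall γ (c d) := by
    ext y
    rw [mem_iUnion, mem_pBall, sub_zero,
      pi_norm_le_iff_of_nonneg (zpow_nonneg (prime_real_pos p).le _)]
    constructor
    · intro h
      choose d hd using fun i => exists_digit (norm_le_zpow_iff_scaled.1 (h i))
      exact ⟨d, (hmem d y).2 hd⟩
    · rintro ⟨d, hd⟩ i
      rw [norm_le_zpow_iff_scaled]
      have h1 := (hmem d y).1 hd i
      have h2 : ‖((d i : ℕ) : ℚ_[p])‖ ≤ 1 := by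
        have := PadicInt.norm_le_one (p := p) ((d i : ℕ) : ℤ_[p])
        rwa [PadicInt.norm_def, PadicInt.coe_natCast] at this
      have h3 := IsUltrametricDist.norm_add_le_max
        ((p : ℚ_[p]) ^ (γ + 1) * y i - ((d i : ℕ) : ℚ_[p])) ((d i : ℕ) : ℚ_[p])
      rw [sub_add_cancel] at h3
      exact h3.trans (max_le h1.le h2)
  have hdisj : Pairwise (Function.onFun Disjoint fun d => pBall γ (c d)) := by
    intro d e hde
    rw [Function.onFun, Set.disjoint_left]
    intro y hy hy'
    refine hde (funext fun i => digit_unique ?_)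
    have h1 := (hmem d y).1 hy i
    have h2 := (hmem e y).1 hy' i
    have h3 := IsUltrametricDist.norm_add_le_max
      ((p : ℚ_[p]) ^ (γ + 1) * y i - ((e i : ℕ) : ℚ_[p]))
      (((d i : ℕ) : ℚ_[p]) - (p : ℚ_[p]) ^ (γ + 1) * y i)
    rw [norm_sub_rev ((d i : ℕ) : ℚ_[p]), add_comm, sub_add_sub_cancel] at h3
    exact h3.trans_lt (max_lt h2 h1)
  rw [hU, measure_iUnion hdisj fun d => measurableSet_pBall _ _, tsum_fintype]
  have : ∀ d, haar p n (pBall γ (c d)) = haar p n (pBall γ 0) := fun d => by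
    exact haar_pBall_center _ _
  simp [this]

lemma haar_pBall (γ : ℤ) (a : Qpn p n) :
    haar p n (pBall γ a) = (p : ℝ≥0∞) ^ ((n : ℝ) * γ) := by
  have hp0 := prime_ennreal_ne_zero p
  have hpt := prime_ennreal_ne_top p
  rw [haar_pBall_center]
  have hstep : ∀ δ : ℤ, (p : ℝ≥0∞) ^ ((n : ℝ) * (δ + 1 : ℤ)) =
      (p : ℝ≥0∞) ^ n * (p : ℝ≥0∞) ^ ((n : ℝ) * δ) := by
    intro δ
    rw [← ENNReal.rpow_natCast, ← ENNReal.rpow_add _ _ hp0 hpt]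
    push_cast
    ring_nf
  have hpn0 : (p : ℝ≥0∞) ^ n ≠ 0 := pow_ne_zero _ hp0
  have hpnt : (p : ℝ≥0∞) ^ n ≠ ∞ := ENNReal.pow_ne_top hpt
  induction γ using Int.induction_on with
  | zero =>
    have : pBall 0 (0 : Qpn p n) = (unitBall p n : Set (Qpn p n)) := by
      simp [pBall, unitBall]
      rfl
    rw [this, haar, Measure.addHaarMeasure_self]
    simp
  | succ k ih =>
    have h := hstep k
    rw [haar_pBall_zero_succ, ih, h]
  | pred k ih =>
    have h1 := haar_pBall_zero_succ (p := p) (n := n) (-(k : ℤ) - 1)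
    have h2 := hstep (-(k : ℤ) - 1)
    rw [sub_add_cancel] at h1 h2
    rw [ih, h2] at h1
    exact ((ENNReal.mul_right_inj hpn0 hpnt).1 h1).symm

lemma haar_pBall_ne_zero (γ : ℤ) (a : Qpn p n) : haar p n (pBall γ a) ≠ 0 := by
  rw [haar_pBall]
  exact (ENNReal.rpow_pos (pos_iff_ne_zero.2 (prime_ennreal_ne_zero p))
    (prime_ennreal_ne_top p)).ne'

lemma haar_pBall_ne_top (γ : ℤ) (a : Qpn p n) : haar p n (pBall γ a) ≠ ∞ := by
  rw [haar_pBall]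
  exact ENNReal.rpow_ne_top_of_ne_zero (prime_ennreal_ne_zero p) (prime_ennreal_ne_top p)

/-- A real radius is rounded down to a power of p; the summand 1 pays for the rounding and δ for the
dilation by t. -/
lemma closedBall_mul_pow_subset (δ : ℕ) {t ε : ℝ} (ht0 : 0 ≤ t) (ht' : t ≤ (p : ℝ) ^ δ) (hε : 0 < ε)
    (x : Qpn p n) : ∃ γ : ℤ, pBall γ x ⊆ closedBall x ε ∧
      closedBall x (t * ε) ⊆ pBall (γ + 1 + δ) x := by
  obtain ⟨γ, h1, h2⟩ := exists_mem_Ico_zpow hε (one_lt_prime_real p)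
  refine ⟨γ, closedBall_subset_closedBall h1, closedBall_subset_closedBall ?_⟩
  rw [zpow_add₀ (prime_real_pos p).ne', zpow_natCast, mul_comm t]
  exact mul_le_mul h2.le ht' ht0 (zpow_nonneg (prime_real_pos p).le _)

/-- Doubling gives access to the Lebesgue differentiation theorem. One factor p^n of the constant
comes from rounding the radius, the other from 2 ≤ p. -/
instance : IsUnifLocDoublingMeasure (haar p n) := by
  refine ⟨(p : ℝ≥0) ^ (2 * (n : ℝ)), eventually_nhdsWithin_of_forall fun ε hε x => ?_⟩
  obtain ⟨γ, h1, h2⟩ := closedBall_mul_pow_subset (p := p) 1 zero_le_two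
    (by simpa using (by exact_mod_cast (Fact.out : p.Prime).two_le : (2 : ℝ) ≤ p)) hε x
  refine (measure_mono h2).trans (le_trans (le_of_eq ?_) (mul_le_mul_right (measure_mono h1) _))
  rw [haar_pBall, haar_pBall, ENNReal.coe_rpow_of_nonneg _ (by positivity), ENNReal.coe_natCast,
    ← ENNReal.rpow_add _ _ (prime_ennreal_ne_zero p) (prime_ennreal_ne_top p)]
  push_cast
  ring_nf

/-! ### The integrable error weight -/

/-- The integrable weight `(p + |y|) ^ (-(n + 1))`. -/
noncomputable def decayWeight (y : Qpn p n) : ℝ≥0∞ :=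
  ENNReal.ofReal (((p : ℝ) + ‖y‖) ^ (-((n : ℝ) + 1)))

lemma measurable_decayWeight : Measurable (decayWeight (p := p) (n := n)) := by
  unfold decayWeight
  fun_prop

lemma decayWeight_le_one (y : Qpn p n) : decayWeight y ≤ 1 := by
  unfold decayWeight
  rw [ENNReal.ofReal_le_one]
  refine Real.rpow_le_one_of_one_le_of_nonpos ?_ ?_
  · linarith [one_lt_prime_real p, norm_nonneg y]
  · have : (0 : ℝ) ≤ n := n.cast_nonneg
    linarith

/-- Outside B_k(0) the weight is at most p^(-(n+1)k), while B_(k+1)(0) has measure p^(n(k+1));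
summing over shells leaves a geometric series of ratio 1/p. -/
lemma lintegral_decayWeight_lt_top : ∫⁻ y, decayWeight (p := p) (n := n) y ∂(haar p n) < ∞ := by
  have hp0 := prime_ennreal_ne_zero p
  have hp1 := one_lt_prime_real p
  set c : ℕ → ℝ≥0∞ := fun k => (p : ℝ≥0∞) ^ (-(((n : ℝ) + 1) * k)) with hc
  have hpt : ∀ y : Qpn p n,
      decayWeight y ≤ ∑' k : ℕ, (pBall ((k : ℤ) + 1) 0).indicator (fun _ => c k) y := by
    intro y
    have hex : ∃ k : ℕ, y ∈ pBall ((k : ℤ) + 1) 0 := by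
      obtain ⟨k, hk⟩ := pow_unbounded_of_one_lt ‖y‖ hp1
      refine ⟨k, ?_⟩
      rw [mem_pBall, sub_zero]
      refine hk.le.trans ?_
      rw [← zpow_natCast]
      exact zpow_le_zpow_right₀ hp1.le (by omega)
    classical
    obtain ⟨k, hk, hmin⟩ : ∃ k : ℕ, y ∈ pBall ((k : ℤ) + 1) 0 ∧
        ∀ m < k, y ∉ pBall ((m : ℤ) + 1) 0 :=
      ⟨Nat.find hex, Nat.find_spec hex, fun m hm => Nat.find_min hex hm⟩
    refine le_trans ?_ (ENNReal.le_tsum k)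
    rw [indicator_of_mem hk]
    rcases Nat.eq_zero_or_pos k with rfl | hpos
    · simpa [hc] using decayWeight_le_one y
    · have hlow : (p : ℝ) ^ (k : ℝ) ≤ (p : ℝ) + ‖y‖ := by
        have := hmin (k - 1) (by omega)
        rw [mem_pBall, sub_zero, not_le, Nat.cast_sub hpos, Nat.cast_one, sub_add_cancel,
          zpow_natCast] at this
        rw [Real.rpow_natCast]
        linarith
      rw [decayWeight, hc]
      have hcast : (p : ℝ≥0∞) = ENNReal.ofReal (p : ℝ) := by simp
      beta_reduce
      rw [hcast, ENNReal.ofReal_rpow_of_pos (prime_real_pos p)]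
      refine ENNReal.ofReal_le_ofReal ?_
      have h := Real.rpow_le_rpow_of_nonpos (by positivity) hlow
        (show -((n : ℝ) + 1) ≤ 0 by have : (0 : ℝ) ≤ n := n.cast_nonneg; linarith)
      refine h.trans (le_of_eq ?_)
      rw [← Real.rpow_mul (prime_real_pos p).le]
      ring_nf
  calc ∫⁻ y, decayWeight (p := p) (n := n) y ∂(haar p n)
      ≤ ∫⁻ y, ∑' k : ℕ, (pBall ((k : ℤ) + 1) 0).indicator (fun _ => c k) y ∂(haar p n) :=
        lintegral_mono hpt
    _ = ∑' k : ℕ, (p : ℝ≥0∞) ^ n * ((p : ℝ≥0∞)⁻¹) ^ k := by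
        rw [lintegral_tsum fun k =>
          (measurable_const.indicator (measurableSet_pBall _ _)).aemeasurable]
        refine tsum_congr fun k => ?_
        rw [lintegral_indicator_const (measurableSet_pBall _ _), haar_pBall, hc,
          ← ENNReal.rpow_add _ _ hp0 (prime_ennreal_ne_top p), ← ENNReal.rpow_natCast,
          ← ENNReal.rpow_natCast, ← ENNReal.rpow_neg_one, ← ENNReal.rpow_mul,
          ← ENNReal.rpow_add _ _ hp0 (prime_ennreal_ne_top p)]
        push_cast
        ring_nf
    _ < ∞ := by
        rw [ENNReal.tsum_mul_left, ENNReal.tsum_geometric]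
        refine ENNReal.mul_lt_top (ENNReal.pow_lt_top (prime_ennreal_ne_top p).lt_top) ?_
        rw [ENNReal.inv_lt_top, tsub_pos_iff_lt, ENNReal.inv_lt_one]
        exact_mod_cast (Fact.out : p.Prime).one_lt

/-! ### The Hardy–Littlewood maximal theorem -/

/-- The average of `G` over the ball `B_γ(x)`. -/
noncomputable def ballAverage (G : Qpn p n → ℝ≥0∞) (γ : ℤ) (x : Qpn p n) : ℝ≥0∞ :=
  (haar p n (pBall γ x))⁻¹ * ∫⁻ y in pBall γ x, G y ∂(haar p n)

/-- The Hardy–Littlewood maximal function. -/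
noncomputable def maximalFunction (G : Qpn p n → ℝ≥0∞) (x : Qpn p n) : ℝ≥0∞ :=
  ⨆ γ : ℤ, ballAverage G γ x

lemma measurable_lintegral_pBall {F : Qpn p n → Qpn p n → ℝ≥0∞}
    (hF : Measurable (Function.uncurry F)) (γ : ℤ) :
    Measurable fun x => ∫⁻ y in pBall γ x, F x y ∂(haar p n) := by
  have hS : MeasurableSet {z : Qpn p n × Qpn p n | z.2 ∈ pBall γ z.1} := by
    have : {z : Qpn p n × Qpn p n | z.2 ∈ pBall γ z.1} =
        {z | dist z.2 z.1 ≤ (p : ℝ) ^ γ} := rfl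
    rw [this]
    exact (isClosed_le (by fun_prop) continuous_const).measurableSet
  have h := (hF.indicator hS).lintegral_prod_right' (ν := haar p n)
  convert h using 2 with x
  rw [← lintegral_indicator (measurableSet_pBall _ _)]
  rfl

lemma measurable_ballAverage {G : Qpn p n → ℝ≥0∞} (hG : Measurable G) (γ : ℤ) :
    Measurable (ballAverage G γ) := by
  unfold ballAverage
  simp_rw [haar_pBall]
  exact (measurable_lintegral_pBall (F := fun _ y => G y) (hG.comp measurable_snd) γ).const_mul _

lemma measurable_maximalFunction {G : Qpn p n → ℝ≥0∞} (hG : Measurable G) :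
    Measurable (maximalFunction G) :=
  Measurable.iSup fun γ => measurable_ballAverage hG γ

lemma ballAverage_mono {G H : Qpn p n → ℝ≥0∞} (h : ∀ y, G y ≤ H y) (γ : ℤ) (x : Qpn p n) :
    ballAverage G γ x ≤ ballAverage H γ x :=
  mul_le_mul_right (lintegral_mono h) _

lemma ballAverage_le_maximalFunction (G : Qpn p n → ℝ≥0∞) (γ : ℤ) (x : Qpn p n) :
    ballAverage G γ x ≤ maximalFunction G x := le_iSup (fun γ => ballAverage G γ x) γ

lemma haar_mul_ballAverage (G : Qpn p n → ℝ≥0∞) (γ : ℤ) (x : Qpn p n) :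
    haar p n (pBall γ x) * ballAverage G γ x = ∫⁻ y in pBall γ x, G y ∂(haar p n) := by
  rw [ballAverage, ← mul_assoc, ENNReal.mul_inv_cancel (haar_pBall_ne_zero _ _)
    (haar_pBall_ne_top _ _), one_mul]

lemma ballAverage_const (c : ℝ≥0∞) (γ : ℤ) (x : Qpn p n) :
    ballAverage (fun _ => c) γ x = c := by
  rw [ballAverage, setLIntegral_const, mul_comm c, ← mul_assoc,
    ENNReal.inv_mul_cancel (haar_pBall_ne_zero _ _) (haar_pBall_ne_top _ _), one_mul]

lemma haar_pBall_add (γ δ : ℤ) (a : Qpn p n) :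
    haar p n (pBall (γ + δ) a) = (p : ℝ≥0∞) ^ ((n : ℝ) * δ) * haar p n (pBall γ a) := by
  rw [haar_pBall, haar_pBall,
    ← ENNReal.rpow_add _ _ (prime_ennreal_ne_zero p) (prime_ennreal_ne_top p)]
  push_cast
  ring_nf

/-- The weak type (1,1) inequality, by Vitali covering of the balls on which the average exceeds t.
-/
theorem haar_lt_maximalFunction_le (hn : 1 ≤ n) (G : Qpn p n → ℝ≥0∞) {t : ℝ≥0∞} (ht : t ≠ 0)
    (ht' : t ≠ ∞) :
    haar p n {x | t < maximalFunction G x} ≤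
      (p : ℝ≥0∞) ^ ((n : ℝ) * (2 : ℤ)) * (t⁻¹ * ∫⁻ y, G y ∂(haar p n)) := by
  have hp1 := one_lt_prime_real p
  set μ := haar p n with hμ
  set c := (p : ℝ≥0∞) ^ ((n : ℝ) * (2 : ℤ)) with hc
  have hc0 : c ≠ 0 :=
    (ENNReal.rpow_pos (pos_iff_ne_zero.2 (prime_ennreal_ne_zero p)) (prime_ennreal_ne_top p)).ne'
  by_cases hI : ∫⁻ y, G y ∂μ = ∞
  · rw [hI, ENNReal.mul_top (ENNReal.inv_ne_zero.2 ht'), ENNReal.mul_top hc0]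
    exact le_top
  let T : Set (Qpn p n × ℤ) := {a | t * μ (pBall a.2 a.1) < ∫⁻ y in pBall a.2 a.1, G y ∂μ}
  -- Vitali needs bounded radii: a ball in T has measure p^(nγ) at most t⁻¹ ∫ G, and p^γ ≤ p^(nγ)
  -- for γ ≥ 0 because n ≥ 1.
  have hbdd : ∀ a ∈ T, (p : ℝ) ^ a.2 ≤ 1 + (t⁻¹ * ∫⁻ y, G y ∂μ).toReal := by
    rintro ⟨x, γ⟩ h
    have hnn : 0 ≤ (t⁻¹ * ∫⁻ y, G y ∂μ).toReal := ENNReal.toReal_nonneg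
    have hlt : t * μ (pBall γ x) < ∫⁻ y in pBall γ x, G y ∂μ := h
    rcases le_total γ 0 with hγ | hγ
    · have := zpow_le_one_of_nonpos₀ hp1.le hγ
      simp only
      linarith
    · have h1 : μ (pBall γ x) ≤ t⁻¹ * ∫⁻ y, G y ∂μ := by
        rw [← ENNReal.div_eq_inv_mul, ENNReal.le_div_iff_mul_le (Or.inl ht) (Or.inl ht'), mul_comm]
        exact hlt.le.trans (setLIntegral_le_lintegral _ _)
      have h2 := ENNReal.toReal_mono (ENNReal.mul_ne_top (ENNReal.inv_ne_top.2 ht) hI) h1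
      rw [haar_pBall, ← ENNReal.toReal_rpow, ENNReal.toReal_natCast] at h2
      have h3 : (p : ℝ) ^ (γ : ℝ) ≤ (p : ℝ) ^ ((n : ℝ) * γ) := by
        refine Real.rpow_le_rpow_of_exponent_le hp1.le ?_
        have h4 : (1 : ℝ) ≤ n := by exact_mod_cast hn
        have h5 : (0 : ℝ) ≤ γ := by exact_mod_cast hγ
        nlinarith
      rw [Real.rpow_intCast] at h3
      simp only
      linarith
  -- The enlargement factor 4 satisfies 4 ≤ p², so enlarged balls fit into balls of index γ + 2,
  -- whence the constant p^(2n).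
  obtain ⟨u, huT, hdisj, hcov⟩ := Vitali.exists_disjoint_subfamily_covering_enlargement_closedBall
    T (fun a => a.1) (fun a => (p : ℝ) ^ a.2) _ hbdd 4 (by norm_num)
  have hucount : u.Countable := hdisj.countable_of_nonempty_interior fun a _ =>
    ⟨a.1, ball_subset_interior_closedBall (mem_ball_self (zpow_pos (prime_real_pos p) _))⟩
  have hsub : {x | t < maximalFunction G x} ⊆ ⋃ a ∈ u, pBall (a.2 + 2) a.1 := by
    intro x hx
    obtain ⟨γ, hγ⟩ := lt_iSup_iff.1 (show t < ⨆ γ, ballAverage G γ x from hx)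
    have hT : (x, γ) ∈ T := by
      have := ENNReal.mul_lt_mul_right (haar_pBall_ne_zero γ x) (haar_pBall_ne_top γ x) hγ
      rw [haar_mul_ballAverage, mul_comm] at this
      exact this
    obtain ⟨a, hau, ha⟩ := hcov _ hT
    refine mem_iUnion₂.2 ⟨a, hau, closedBall_subset_closedBall ?_ (ha (self_mem_pBall γ x))⟩
    rw [zpow_add₀ (prime_real_pos p).ne', mul_comm]
    have h2 : (2 : ℝ) ≤ p := by exact_mod_cast (Fact.out : p.Prime).two_le
    refine mul_le_mul_of_nonneg_left ?_ (zpow_nonneg (prime_real_pos p).le _)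
    norm_cast at *
    nlinarith
  calc μ {x | t < maximalFunction G x} ≤ μ (⋃ a ∈ u, pBall (a.2 + 2) a.1) := measure_mono hsub
    _ ≤ ∑' a : u, μ (pBall (a.1.2 + 2) a.1.1) := measure_biUnion_le μ hucount _
    _ ≤ ∑' a : u, c * (t⁻¹ * ∫⁻ y in pBall a.1.2 a.1.1, G y ∂μ) := by
        refine ENNReal.tsum_le_tsum fun a => ?_
        rw [haar_pBall_add]
        refine mul_le_mul_right ?_ _
        rw [← ENNReal.div_eq_inv_mul, ENNReal.le_div_iff_mul_le (Or.inl ht) (Or.inl ht'), mul_comm]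
        exact (huT a.2).le
    _ = c * (t⁻¹ * ∫⁻ y in ⋃ a ∈ u, pBall a.2 a.1, G y ∂μ) := by
        rw [ENNReal.tsum_mul_left, ENNReal.tsum_mul_left,
          lintegral_biUnion hucount (fun a _ => measurableSet_pBall _ _) hdisj]
    _ ≤ c * (t⁻¹ * ∫⁻ y, G y ∂μ) := by
        gcongr
        exact Measure.restrict_le_self

/-- The part of G below t/2 contributes at most t/2 to any average, so the weak type bound is needed
only for the rest, at level t/2. -/
theorem haar_lt_maximalFunction_le_setLIntegral (hn : 1 ≤ n) {G : Qpn p n → ℝ≥0∞}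
    (hG : Measurable G) {t : ℝ≥0∞} (ht : t ≠ 0) (ht' : t ≠ ∞) :
    haar p n {x | t < maximalFunction G x} ≤
      (p : ℝ≥0∞) ^ ((n : ℝ) * (2 : ℤ)) *
        (2 * t⁻¹ * ∫⁻ y in {y | t < 2 * G y}, G y ∂(haar p n)) := by
  have hS : MeasurableSet {y | t < 2 * G y} := measurableSet_lt measurable_const (hG.const_mul _)
  set G₁ := ({y | t < 2 * G y}).indicator G with hG₁
  have hle : ∀ x, maximalFunction G x ≤ maximalFunction G₁ x + t / 2 := by
    intro x
    refine iSup_le fun γ => ?_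
    calc ballAverage G γ x ≤ ballAverage (fun y => G₁ y + t / 2) γ x := by
          refine ballAverage_mono (fun y => ?_) γ x
          by_cases hy : t < 2 * G y
          · rw [hG₁, indicator_of_mem (show y ∈ {y | t < 2 * G y} from hy)]
            exact le_self_add
          · refine le_add_left ?_
            rw [ENNReal.le_div_iff_mul_le (by simp) (by simp), mul_comm]
            exact not_lt.1 hy
      _ = ballAverage G₁ γ x + t / 2 := by
          conv_rhs => rw [← ballAverage_const (t / 2) γ x]
          rw [ballAverage, ballAverage, ballAverage,
            lintegral_add_right _ measurable_const, mul_add]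
      _ ≤ _ := by gcongr; exact ballAverage_le_maximalFunction _ _ _
  have hsub : {x | t < maximalFunction G x} ⊆ {x | t / 2 < maximalFunction G₁ x} := by
    intro x hx
    by_contra h
    have h1 : maximalFunction G₁ x ≤ t / 2 := not_lt.1 h
    have h2 := (hle x).trans (add_le_add_left h1 _)
    rw [ENNReal.add_halves] at h2
    exact absurd hx (not_lt.2 h2)
  refine (measure_mono hsub).trans ((haar_lt_maximalFunction_le hn G₁ (by simpa using ht)
    (ENNReal.div_ne_top ht' (by simp))).trans (le_of_eq ?_))
  rw [hG₁, lintegral_indicator hS, ENNReal.inv_div (by simp) (by simp), div_eq_mul_inv]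

/-- **Hardy–Littlewood maximal theorem** on `ℚ_p^n`. -/
theorem lintegral_maximalFunction_rpow_le (hn : 1 ≤ n) {s : ℝ} (hs : 1 < s) :
    ∃ C : ℝ≥0, ∀ G : Qpn p n → ℝ≥0∞, Measurable G → (∀ y, G y ≠ ∞) →
      ∫⁻ x, maximalFunction G x ^ s ∂(haar p n) ≤ C * ∫⁻ x, G x ^ s ∂(haar p n) := by
  set μ := haar p n with hμ
  set c := (p : ℝ≥0∞) ^ ((n : ℝ) * (2 : ℤ)) with hc
  have hct : c ≠ ∞ :=
    ENNReal.rpow_ne_top_of_ne_zero (prime_ennreal_ne_zero p) (prime_ennreal_ne_top p)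
  set K : ℝ≥0∞ := ENNReal.ofReal s * (c * 2 * ((ENNReal.ofReal (s - 1))⁻¹ * 2 ^ (s - 1))) with hK
  have hKt : K ≠ ∞ := by
    refine ENNReal.mul_ne_top ENNReal.ofReal_ne_top (ENNReal.mul_ne_top
      (ENNReal.mul_ne_top hct (by simp)) (ENNReal.mul_ne_top ?_ ?_))
    · simpa using hs
    · exact ENNReal.rpow_ne_top_of_nonneg (by linarith) (by simp)
  refine ⟨K.toNNReal, fun G hG hGt => ?_⟩
  rw [ENNReal.coe_toNNReal hKt]
  -- With this measure the usual exchange of integrals becomes a second layer cake formula, for 2G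
  -- with exponent s - 1.
  set ν := μ.withDensity G with hν
  have hM := measurable_maximalFunction hG
  have h2G : Measurable fun y => (2 * G y).toReal := (hG.const_mul _).ennreal_toReal
  -- The layer cake formula is stated for real functions, so the maximal function is truncated at k
  -- and the bound passes to the limit by monotone convergence.
  have htrunc : ∀ k : ℕ, ∫⁻ x, (min (maximalFunction G x) k) ^ s ∂μ ≤ K * ∫⁻ x, G x ^ s ∂μ := by
    intro k
    have hfin : ∀ x, min (maximalFunction G x) (k : ℝ≥0∞) ≠ ∞ := fun x =>
      (min_le_right _ _).trans_lt (ENNReal.natCast_lt_top k) |>.ne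
    have hlevel : ∀ t ∈ Ioi (0 : ℝ), μ {x | t < (min (maximalFunction G x) k).toReal} *
        ENNReal.ofReal (t ^ (s - 1)) ≤
        c * 2 * (ν {y | t < (2 * G y).toReal} * ENNReal.ofReal (t ^ (s - 1 - 1))) := by
      intro t ht
      have ht0 : (0 : ℝ) < t := ht
      have hset : {y | t < (2 * G y).toReal} = {y | ENNReal.ofReal t < 2 * G y} := by
        ext y
        exact (ENNReal.ofReal_lt_iff_lt_toReal ht0.le (ENNReal.mul_ne_top (by simp) (hGt y))).symm
      have h1 : μ {x | t < (min (maximalFunction G x) k).toReal} ≤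
          c * (2 * (ENNReal.ofReal t)⁻¹ * ν {y | t < (2 * G y).toReal}) := by
        rw [hset, hν, withDensity_apply _ (measurableSet_lt measurable_const (hG.const_mul _))]
        refine le_trans (measure_mono ?_) (haar_lt_maximalFunction_le_setLIntegral hn hG
          (by simpa using ht0) ENNReal.ofReal_ne_top)
        intro x hx
        have := (ENNReal.ofReal_lt_iff_lt_toReal ht0.le (hfin x)).2 hx
        exact this.trans_le (min_le_left _ _)
      refine (mul_le_mul_left h1 _).trans (le_of_eq ?_)
      have h2 : ENNReal.ofReal (t ^ (s - 1 - 1)) =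
          (ENNReal.ofReal t)⁻¹ * ENNReal.ofReal (t ^ (s - 1)) := by
        rw [Real.rpow_sub_one ht0.ne', div_eq_inv_mul, ENNReal.ofReal_mul (by positivity),
          ENNReal.ofReal_inv_of_pos ht0]
      rw [h2]
      ring
    have hcomp : ∫⁻ y, ENNReal.ofReal ((2 * G y).toReal ^ (s - 1)) ∂ν =
        2 ^ (s - 1) * ∫⁻ x, G x ^ s ∂μ := by
      rw [hν, lintegral_withDensity_eq_lintegral_mul _ hG (h2G.pow_const _).ennreal_ofReal,
        ← lintegral_const_mul _ (hG.pow_const _)]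
      refine lintegral_congr fun y => ?_
      rw [Pi.mul_apply, ← ENNReal.ofReal_rpow_of_nonneg ENNReal.toReal_nonneg (by linarith),
        ENNReal.ofReal_toReal (ENNReal.mul_ne_top (by simp) (hGt y)),
        ENNReal.mul_rpow_of_nonneg _ _ (by linarith)]
      have : G y ^ s = G y * G y ^ (s - 1) := by
        conv_lhs => rw [show s = 1 + (s - 1) by ring,
          ENNReal.rpow_add_of_nonneg _ _ zero_le_one (by linarith), ENNReal.rpow_one]
      rw [this]
      ring
    have hlay := lintegral_rpow_eq_lintegral_meas_lt_mul ν
      (f := fun y => (2 * G y).toReal) (ae_of_all _ fun y => ENNReal.toReal_nonneg)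
      h2G.aemeasurable (sub_pos.2 hs)
    rw [hcomp] at hlay
    have hs0 : ENNReal.ofReal (s - 1) ≠ 0 := by simpa using hs
    calc ∫⁻ x, (min (maximalFunction G x) k) ^ s ∂μ
        = ∫⁻ x, ENNReal.ofReal ((min (maximalFunction G x) k).toReal ^ s) ∂μ := by
          refine lintegral_congr fun x => ?_
          rw [← ENNReal.ofReal_rpow_of_nonneg ENNReal.toReal_nonneg (by linarith),
            ENNReal.ofReal_toReal (hfin x)]
      _ = ENNReal.ofReal s * ∫⁻ t in Ioi (0 : ℝ),
            μ {x | t < (min (maximalFunction G x) k).toReal} * ENNReal.ofReal (t ^ (s - 1)) :=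
          lintegral_rpow_eq_lintegral_meas_lt_mul μ
            (f := fun x => (min (maximalFunction G x) k).toReal)
            (ae_of_all _ fun y => ENNReal.toReal_nonneg)
            (hM.min measurable_const).ennreal_toReal.aemeasurable (by linarith)
      _ ≤ ENNReal.ofReal s * ∫⁻ t in Ioi (0 : ℝ),
            c * 2 * (ν {y | t < (2 * G y).toReal} * ENNReal.ofReal (t ^ (s - 1 - 1))) := by
          exact mul_le_mul_right (setLIntegral_mono' measurableSet_Ioi hlevel) _
      _ = ENNReal.ofReal s * (c * 2 * ((ENNReal.ofReal (s - 1))⁻¹ *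
            (ENNReal.ofReal (s - 1) * ∫⁻ t in Ioi (0 : ℝ),
              ν {y | t < (2 * G y).toReal} * ENNReal.ofReal (t ^ (s - 1 - 1))))) := by
          rw [lintegral_const_mul' _ _ (ENNReal.mul_ne_top hct (by simp)),
            ← mul_assoc (ENNReal.ofReal (s - 1))⁻¹,
            ENNReal.inv_mul_cancel hs0 ENNReal.ofReal_ne_top, one_mul]
      _ = K * ∫⁻ x, G x ^ s ∂μ := by
          rw [← hlay, hK]
          ring
  have hsup : ∀ x, maximalFunction G x ^ s = ⨆ k : ℕ, (min (maximalFunction G x) k) ^ s := by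
    intro x
    have h := (ENNReal.orderIsoRpow s (by linarith)).map_iSup
      (fun k : ℕ => min (maximalFunction G x) (k : ℝ≥0∞))
    simp only [ENNReal.orderIsoRpow_apply] at h
    rw [← h, ← inf_iSup_eq, ENNReal.iSup_natCast, inf_top_eq]
  simp_rw [hsup]
  rw [lintegral_iSup (fun k => (hM.min measurable_const).pow_const _)]
  · exact iSup_le htrunc
  · intro j k hjk x
    exact ENNReal.rpow_le_rpow (min_le_min le_rfl (by exact_mod_cast hjk)) (by linarith)

/-! ### Log-Hölder exponents and reference exponents -/

lemma one_le_logb_add_norm (y : Qpn p n) : 1 ≤ Real.logb p (p + ‖y‖) := by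
  rw [Real.le_logb_iff_rpow_le (one_lt_prime_real p)
    (add_pos_of_pos_of_nonneg (prime_real_pos p) (norm_nonneg y)), Real.rpow_one]
  exact le_add_of_nonneg_right (norm_nonneg y)

lemma decayWeight_eq_rpow (y : Qpn p n) :
    decayWeight y = (p : ℝ≥0∞) ^ (-((n + 1) * Real.logb p (p + ‖y‖))) := by
  have hp := prime_real_pos p
  have h : ((p : ℝ) + ‖y‖) = (p : ℝ) ^ Real.logb p (p + ‖y‖) :=
    (Real.rpow_logb hp (one_lt_prime_real p).ne'
      (add_pos_of_pos_of_nonneg hp (norm_nonneg y))).symm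
  have hcast : (p : ℝ≥0∞) = ENNReal.ofReal (p : ℝ) := by simp
  rw [decayWeight, h, ← Real.rpow_mul hp.le, hcast, ENNReal.ofReal_rpow_of_pos hp, ← h]
  ring_nf

/-- Comparison of powers of a number at most one, whose exponents differ by `O(1 / log |y|)`. -/
lemma rpow_le_mul_rpow_add_decayWeight {t : ℝ≥0∞} (ht : t ≤ 1) {a₀ a b C : ℝ} (ha₀ : 0 < a₀)
    (ha : a₀ ≤ a) (hC : 0 ≤ C) (y : Qpn p n)
    (hab : |a - b| ≤ C / Real.logb p (p + ‖y‖)) :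
    t ^ a ≤ (p : ℝ≥0∞) ^ ((n + 1) * C / a₀) * t ^ b + decayWeight y := by
  have hp0 := prime_ennreal_ne_zero p
  have hpt := prime_ennreal_ne_top p
  have hp1 := one_le_prime_ennreal p
  set l := Real.logb p (p + ‖y‖) with hl
  have hl1 : 1 ≤ l := one_le_logb_add_norm y
  have hn : (0 : ℝ) ≤ n := n.cast_nonneg
  -- The threshold is chosen so that w^a₀ is the decay weight and w^(-C/l) is a constant: below it
  -- t^a is absorbed by the weight, above it changing the exponent costs that constant.
  set w : ℝ≥0∞ := (p : ℝ≥0∞) ^ (-((n + 1) * l / a₀)) with hw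
  rcases le_total t w with h | h
  · refine le_add_left ((ENNReal.rpow_le_rpow h (ha₀.le.trans ha)).trans ?_)
    rw [decayWeight_eq_rpow, hw, ← ENNReal.rpow_mul]
    refine ENNReal.rpow_le_rpow_of_exponent_le hp1 ?_
    rw [neg_mul, neg_le_neg_iff, div_mul_eq_mul_div, le_div_iff₀ ha₀]
    exact mul_le_mul_of_nonneg_left ha (by positivity)
  · refine le_add_right ?_
    have hw0 : w ≠ 0 := (ENNReal.rpow_pos (pos_iff_ne_zero.2 hp0) hpt).ne'
    have ht0 : t ≠ 0 := (lt_of_lt_of_le (pos_iff_ne_zero.2 hw0) h).ne'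
    have htt : t ≠ ∞ := (ht.trans_lt ENNReal.one_lt_top).ne
    have h1 : t ^ a = t ^ (a - b) * t ^ b := by
      rw [← ENNReal.rpow_add _ _ ht0 htt, sub_add_cancel]
    rw [h1]
    refine mul_le_mul_left ?_ _
    calc t ^ (a - b) ≤ t ^ (-(C / l)) :=
          ENNReal.rpow_le_rpow_of_exponent_ge ht (by linarith [neg_abs_le (a - b)])
      _ ≤ w ^ (-(C / l)) := by
          rw [ENNReal.rpow_neg, ENNReal.rpow_neg, ENNReal.inv_le_inv]
          exact ENNReal.rpow_le_rpow h (by positivity)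
      _ = (p : ℝ≥0∞) ^ ((n + 1) * C / a₀) := by
          rw [hw, ← ENNReal.rpow_mul]
          congr 1
          field_simp

/-- A number `q₀` by which the exponent `q` may be replaced in the computation of the norm of the
indicator function of the ball `B_γ(a)`: a value of `q` on a small ball, or the value of `q` at
infinity for a large ball. -/
def IsRefExponent (C : ℝ) (γ : ℤ) (a : Qpn p n) (q : Qpn p n → ℝ) (q₀ : ℝ) : Prop :=
  (γ ≤ 0 ∧ ∀ᵐ y ∂((haar p n).restrict (pBall γ a)), -(γ : ℝ) * |q y - q₀| ≤ C) ∨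
    (0 ≤ γ ∧ ∀ y, |q y - q₀| ≤ C / Real.logb p (p + ‖y‖))

/-- Reference exponents pass through Lipschitz maps of the exponent, in particular to the Sobolev
and the conjugate exponents. -/
lemma IsRefExponent.of_abs_sub_le {C L : ℝ} {γ : ℤ} {a : Qpn p n} {q q' : Qpn p n → ℝ} {q₀ q₀' : ℝ}
    (h : IsRefExponent C γ a q q₀) (hL : 0 ≤ L) (hq : ∀ y, |q' y - q₀'| ≤ L * |q y - q₀|) :
    IsRefExponent (L * C) γ a q' q₀' := by
  rcases h with ⟨hγ, h⟩ | ⟨hγ, h⟩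
  · refine Or.inl ⟨hγ, h.mono fun y hy => ?_⟩
    have h0 : (0 : ℝ) ≤ -(γ : ℝ) := by
      rw [neg_nonneg]; exact_mod_cast hγ
    calc -(γ : ℝ) * |q' y - q₀'| ≤ -(γ : ℝ) * (L * |q y - q₀|) :=
          mul_le_mul_of_nonneg_left (hq y) h0
      _ = L * (-(γ : ℝ) * |q y - q₀|) := by ring
      _ ≤ L * C := mul_le_mul_of_nonneg_left hy hL
  · refine Or.inr ⟨hγ, fun y => (hq y).trans ?_⟩
    rw [mul_div_assoc]
    exact mul_le_mul_of_nonneg_left (h y) hL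

/-- Were q equal to q₀, the integral would be exactly 1. On small balls the exponent error is
bounded by the local condition; on large balls the base is at most one and the error is absorbed by
the decay weight. -/
lemma exists_lintegral_rpow_le_of_isRefExponent {lo C : ℝ} (hlo : 0 < lo) (hC : 0 ≤ C) :
    ∃ K : ℝ≥0, ∀ (γ : ℤ) (a : Qpn p n) (q : Qpn p n → ℝ) (q₀ : ℝ), (∀ y, lo ≤ q y) → lo ≤ q₀ →
      IsRefExponent C γ a q q₀ →
      ∫⁻ y in pBall γ a, ((p : ℝ≥0∞) ^ (-(n * γ / q₀))) ^ q y ∂(haar p n) ≤ K := by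
  have hp0 := prime_ennreal_ne_zero p
  have hpt := prime_ennreal_ne_top p
  have hp1 := one_le_prime_ennreal p
  have hn : (0 : ℝ) ≤ n := n.cast_nonneg
  set c : ℝ≥0∞ := (p : ℝ≥0∞) ^ ((n + 1) * C / lo) with hc
  have hct : c ≠ ∞ := ENNReal.rpow_ne_top_of_ne_zero hp0 hpt
  set I := ∫⁻ y, decayWeight (p := p) (n := n) y ∂(haar p n) with hI
  have hIt : I ≠ ∞ := lintegral_decayWeight_lt_top.ne
  refine ⟨(c + I).toNNReal, fun γ a q q₀ hq hq₀ href => ?_⟩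
  rw [ENNReal.coe_toNNReal (ENNReal.add_ne_top.2 ⟨hct, hIt⟩)]
  have hq₀' : 0 < q₀ := hlo.trans_le hq₀
  have hcancel : ∫⁻ _ in pBall γ a, c * (p : ℝ≥0∞) ^ (-(n * γ : ℝ)) ∂(haar p n) = c := by
    rw [setLIntegral_const, haar_pBall, mul_assoc, ← ENNReal.rpow_add _ _ hp0 hpt, neg_add_cancel,
      ENNReal.rpow_zero, mul_one]
  rcases href with ⟨hγ, h⟩ | ⟨hγ, h⟩
  · have hγ' : (0 : ℝ) ≤ -(γ : ℝ) := by
      rw [neg_nonneg]; exact_mod_cast hγ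
    refine le_trans (lintegral_mono_ae (h.mono fun y hy => ?_)) (hcancel.le.trans le_self_add)
    rw [hc, ← ENNReal.rpow_mul, ← ENNReal.rpow_add _ _ hp0 hpt]
    refine ENNReal.rpow_le_rpow_of_exponent_le hp1 ?_
    have h1 : -(n * γ / q₀) * q y = n * (-(γ : ℝ) * (q y - q₀)) / q₀ + -(n * γ : ℝ) := by
      field_simp
      ring
    rw [h1]
    gcongr ?_ + _
    have h2 : -(γ : ℝ) * (q y - q₀) ≤ C :=
      (mul_le_mul_of_nonneg_left (le_abs_self _) hγ').trans hy
    calc n * (-(γ : ℝ) * (q y - q₀)) / q₀ ≤ n * C / q₀ := by gcongr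
      _ ≤ n * C / lo := by gcongr
      _ ≤ (n + 1) * C / lo := by gcongr; linarith
  · have hγ' : (0 : ℝ) ≤ γ := by exact_mod_cast hγ
    have ht : (p : ℝ≥0∞) ^ (-(n * γ / q₀)) ≤ 1 := by
      refine (ENNReal.rpow_le_rpow_of_exponent_le hp1 ?_).trans_eq ENNReal.rpow_zero
      exact neg_nonpos.2 (by positivity)
    calc ∫⁻ y in pBall γ a, ((p : ℝ≥0∞) ^ (-(n * γ / q₀))) ^ q y ∂(haar p n)
        ≤ ∫⁻ y in pBall γ a, (c * (p : ℝ≥0∞) ^ (-(n * γ : ℝ)) + decayWeight y) ∂(haar p n) := by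
          refine lintegral_mono fun y => ?_
          refine (rpow_le_mul_rpow_add_decayWeight ht hlo (hq y) hC y (h y)).trans
            (le_of_eq ?_)
          rw [← ENNReal.rpow_mul, neg_mul, div_mul_cancel₀ _ hq₀'.ne']
      _ ≤ c + I := by
          rw [lintegral_add_right _ measurable_decayWeight, hcancel]
          gcongr
          exact setLIntegral_le_lintegral _ _

lemma le_essInf_and_essSup_le {ν : Measure (Qpn p n)} (hν : ν ≠ 0) {f : Qpn p n → ℝ} {lo hi : ℝ}
    (hlo : ∀ x, lo ≤ f x) (hhi : ∀ x, f x ≤ hi) :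
    lo ≤ essInf f ν ∧ essInf f ν ≤ hi ∧
      ∀ᵐ x ∂ν, essInf f ν ≤ f x ∧ f x ≤ essSup f ν := by
  have : (ae ν).NeBot := ae_neBot.2 hν
  have hb1 : IsBoundedUnder (· ≥ ·) (ae ν) f := isBoundedUnder_of ⟨lo, hlo⟩
  have hb2 : IsBoundedUnder (· ≤ ·) (ae ν) f := isBoundedUnder_of ⟨hi, hhi⟩
  have hae1 := ae_essInf_le hb1
  have hae2 := ae_le_essSup hb2
  refine ⟨le_essInf_of_ae_le _ (ae_of_all _ hlo) hb2.isCoboundedUnder_ge, ?_, hae1.and hae2⟩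
  obtain ⟨x, hx⟩ := hae1.exists
  exact hx.trans (hhi x)

lemma haar_restrict_pBall_ne_zero (γ : ℤ) (a : Qpn p n) : (haar p n).restrict (pBall γ a) ≠ 0 := by
  rw [Ne, Measure.restrict_eq_zero]
  exact haar_pBall_ne_zero γ a

/-- The local log-Hölder condition, in terms of the essential infimum over a ball. -/
lemma IsLogHolder.exists_local {r : Qpn p n → ℝ} (hr : IsLogHolder r) :
    ∃ C : ℝ, 0 ≤ C ∧ ∀ (γ : ℤ) (a : Qpn p n),
      ∀ᵐ y ∂((haar p n).restrict (pBall γ a)),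
        essInf r ((haar p n).restrict (pBall γ a)) ≤ r y ∧
        -(γ : ℝ) * (r y - essInf r ((haar p n).restrict (pBall γ a))) ≤ C := by
  obtain ⟨C, hC⟩ := hr.local_cond
  refine ⟨max C 0, le_max_right _ _, fun γ a => ?_⟩
  obtain ⟨-, -, h⟩ := le_essInf_and_essSup_le (haar_restrict_pBall_ne_zero γ a)
    hr.isExponent.essInf_le hr.isExponent.le_essSup
  filter_upwards [h] with y hy
  refine ⟨hy.1, ?_⟩
  rcases le_total γ 0 with hγ | hγ
  · have hγ' : (0 : ℝ) ≤ -(γ : ℝ) := by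
      rw [neg_nonneg]; exact_mod_cast hγ
    refine le_max_of_le_left (le_trans ?_ (hC γ a))
    nlinarith [hy.2]
  · have hγ' : (0 : ℝ) ≤ (γ : ℝ) := by exact_mod_cast hγ
    refine le_max_of_le_right ?_
    nlinarith [hy.1]

/-- A log-Hölder exponent has a value at infinity. -/
lemma IsLogHolder.exists_atInfinity (hn : 1 ≤ n) {r : Qpn p n → ℝ} (hr : IsLogHolder r) :
    ∃ C : ℝ, 0 ≤ C ∧ ∃ r₀, essInf r (haar p n) ≤ r₀ ∧ r₀ ≤ essSup r (haar p n) ∧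
      ∀ y, |r y - r₀| ≤ C / Real.logb p (p + ‖y‖) := by
  obtain ⟨C, hC⟩ := hr.infinity_cond
  have hp := prime_real_pos p
  have : Nonempty (Fin n) := ⟨⟨0, hn⟩⟩
  let x : ℕ → Qpn p n := fun k _ => (p : ℚ_[p]) ^ (-(k : ℤ))
  have hx : ∀ k, ‖x k‖ = (p : ℝ) ^ k := by
    intro k
    rw [show x k = fun _ => (p : ℚ_[p]) ^ (-(k : ℤ)) from rfl, pi_norm_const, Padic.norm_p_zpow,
      neg_neg, zpow_natCast]
  -- Compactness suffices: the values along points of norm p^k have a limit point r₀, and the decay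
  -- condition, where the minimum of the norms is eventually ‖y‖, passes to the limit.
  obtain ⟨r₀, hr₀, φ, hφ, hlim⟩ := (isCompact_Icc (a := essInf r (haar p n))
    (b := essSup r (haar p n))).tendsto_subseq (x := fun k => r (x k))
    fun k => ⟨hr.isExponent.essInf_le _, hr.isExponent.le_essSup _⟩
  have hbound : ∀ y, |r y - r₀| ≤ C / Real.logb p (p + ‖y‖) := by
    intro y
    have h1 : Tendsto (fun k => |r y - r (x (φ k))|) atTop (𝓝 |r y - r₀|) :=
      (tendsto_const_nhds.sub hlim).abs
    refine le_of_tendsto h1 ?_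
    obtain ⟨N, hN⟩ := pow_unbounded_of_one_lt ‖y‖ (one_lt_prime_real p)
    filter_upwards [eventually_ge_atTop N] with k hk
    refine (hC y (x (φ k))).trans (le_of_eq ?_)
    rw [min_eq_left]
    rw [hx]
    exact hN.le.trans (pow_le_pow_right₀ (one_lt_prime_real p).le (hk.trans (hφ.id_le k)))
  refine ⟨C, ?_, r₀, hr₀.1, hr₀.2, hbound⟩
  have h0 := (abs_nonneg _).trans (hbound 0)
  by_contra hneg
  exact absurd h0 (not_le.2 (div_neg_of_neg_of_pos (not_le.1 hneg)
    (one_pos.trans_le (one_le_logb_add_norm _))))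

lemma IsLogHolder.exists_isRefExponent (hn : 1 ≤ n) {r : Qpn p n → ℝ} (hr : IsLogHolder r) :
    ∃ C : ℝ, 0 ≤ C ∧ ∀ (γ : ℤ) (a : Qpn p n), ∃ r₀, essInf r (haar p n) ≤ r₀ ∧
      r₀ ≤ essSup r (haar p n) ∧ IsRefExponent C γ a r r₀ := by
  obtain ⟨C₁, hC₁, h₁⟩ := hr.exists_local
  obtain ⟨C₂, hC₂, r₀, hlo, hhi, h₂⟩ := hr.exists_atInfinity hn
  refine ⟨max C₁ C₂, le_max_of_le_left hC₁, fun γ a => ?_⟩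
  rcases le_total γ 0 with hγ | hγ
  · obtain ⟨h3, h4, -⟩ := le_essInf_and_essSup_le (haar_restrict_pBall_ne_zero γ a)
      hr.isExponent.essInf_le hr.isExponent.le_essSup
    refine ⟨_, h3, h4, Or.inl ⟨hγ, (h₁ γ a).mono fun y hy => ?_⟩⟩
    rw [abs_of_nonneg (sub_nonneg.2 hy.1)]
    exact hy.2.trans (le_max_left _ _)
  · refine ⟨r₀, hlo, hhi, Or.inr ⟨hγ, fun y => (h₂ y).trans ?_⟩⟩
    have := one_le_logb_add_norm y
    gcongr
    exact le_max_right _ _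

/-- Every point of a ball is a centre, so each radius gives only countably many balls, all centred
in a countable dense set; the exceptional null sets can be united. -/
lemma ae_forall_pBall {P : Set (Qpn p n) → ℤ → Qpn p n → Prop}
    (h : ∀ γ a, ∀ᵐ y ∂((haar p n).restrict (pBall γ a)), P (pBall γ a) γ y) :
    ∀ᵐ x ∂(haar p n), ∀ γ, P (pBall γ x) γ x := by
  obtain ⟨D, hDc, hD⟩ := TopologicalSpace.exists_countable_dense (Qpn p n)
  have h1 : ∀ᵐ x ∂(haar p n), ∀ γ : ℤ, ∀ d ∈ D, x ∈ pBall γ d → P (pBall γ d) γ x := by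
    rw [ae_all_iff]
    intro γ
    rw [ae_ball_iff hDc]
    intro d _
    exact (ae_restrict_iff' (measurableSet_pBall γ d)).1 (h γ d)
  filter_upwards [h1] with x hx γ
  obtain ⟨d, hd, hdD⟩ := hD.exists_dist_lt x (zpow_pos (prime_real_pos p) γ)
  have hmem : x ∈ pBall γ d := hdD.le
  have := hx γ d hd hmem
  rwa [← pBall_eq_of_mem hmem] at this

/-! ### Arithmetic of Sobolev and conjugate exponents -/

/-- The Sobolev-type exponent `q` with `1 / q = 1 / t - α`. -/
noncomputable def sobolevExponent (α t : ℝ) : ℝ := (1 / t - α)⁻¹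

section Sobolev

variable {α s R t u : ℝ}

lemma sobolev_pos (hs : 0 < s) (hst : s ≤ t) (htR : t ≤ R) (hR : α < 1 / R) : 0 < 1 / t - α := by
  have := one_div_le_one_div_of_le (hs.trans_le hst) htR
  linarith

lemma le_sobolevExponent (hα : 0 ≤ α) (hs : 0 < s) (hst : s ≤ t) (htR : t ≤ R) (hR : α < 1 / R) :
    t ≤ sobolevExponent α t := by
  have h := sobolev_pos hs hst htR hR
  have ht := hs.trans_le hst
  rw [sobolevExponent, le_inv_comm₀ ht h, ← one_div]
  linarith

lemma sobolevExponent_le (hs : 0 < s) (hst : s ≤ t) (htR : t ≤ R) (hR : α < 1 / R) :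
    sobolevExponent α t ≤ sobolevExponent α R := by
  have h := sobolev_pos (hs.trans_le (hst.trans htR)) le_rfl le_rfl hR
  have := one_div_le_one_div_of_le (hs.trans_le hst) htR
  exact inv_anti₀ h (by linarith)

/-- The difference equals q(t) q(u) (t - u) / (t u), where both factors q are at most q(R) and t u ≥
1. -/
lemma abs_sobolevExponent_sub_le (hs : 1 ≤ s) (hst : s ≤ t) (htR : t ≤ R)
    (hsu : s ≤ u) (huR : u ≤ R) (hR : α < 1 / R) :
    |sobolevExponent α t - sobolevExponent α u| ≤ sobolevExponent α R ^ 2 * |t - u| := by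
  have hs0 : 0 < s := one_pos.trans_le hs
  have ht := sobolev_pos hs0 hst htR hR
  have hu := sobolev_pos hs0 hsu huR hR
  have ht1 : 1 ≤ t := hs.trans hst
  have hu1 : 1 ≤ u := hs.trans hsu
  have h1 : sobolevExponent α t - sobolevExponent α u =
      sobolevExponent α t * sobolevExponent α u * ((t - u) / (t * u)) := by
    have h2 : (t - u) / (t * u) = (1 / u - α) - (1 / t - α) := by
      field_simp
      ring
    rw [h2, sobolevExponent, sobolevExponent]
    generalize 1 / t - α = x at *
    generalize 1 / u - α = y at *
    field_simp
  have hbt := sobolevExponent_le hs0 hst htR hR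
  have hbu := sobolevExponent_le hs0 hsu huR hR
  have ht0 : 0 < sobolevExponent α t := inv_pos.2 ht
  have hu0 : 0 < sobolevExponent α u := inv_pos.2 hu
  rw [h1, abs_mul, abs_div, abs_of_pos (mul_pos ht0 hu0),
    abs_of_pos (show 0 < t * u by positivity), sq]
  exact mul_le_mul (mul_le_mul hbt hbu hu0.le (ht0.le.trans hbt))
    (div_le_self (abs_nonneg _) (one_le_mul_of_one_le_of_one_le ht1 hu1)) (by positivity)
    (mul_nonneg (ht0.le.trans hbt) (ht0.le.trans hbt))

end Sobolev

lemma abs_conjExponent_sub_le {s t u : ℝ} (hs : 1 < s) (ht : s ≤ t) (hu : s ≤ u) :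
    |t.conjExponent - u.conjExponent| ≤ ((s - 1) ^ 2)⁻¹ * |t - u| := by
  have ht1 : 0 < t - 1 := by linarith
  have hu1 : 0 < u - 1 := by linarith
  have h1 : t.conjExponent - u.conjExponent = ((t - 1) * (u - 1))⁻¹ * (u - t) := by
    rw [Real.conjExponent, Real.conjExponent]
    field_simp
    ring
  rw [h1, abs_mul, abs_of_pos (inv_pos.2 (mul_pos ht1 hu1)), abs_sub_comm u t, sq]
  have : 0 < s - 1 := by linarith
  gcongr

/-! ### Modular estimate for the fractional maximal operator -/

/-- The fractional maximal function, with the factor `|B_γ(x)| ^ (β / n) = p ^ (γ β)`. -/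
noncomputable def fractionalMaximal (β : ℝ) (G : Qpn p n → ℝ≥0∞) (x : Qpn p n) : ℝ≥0∞ :=
  ⨆ γ : ℤ, (p : ℝ≥0∞) ^ (γ * β) * ballAverage G γ x

lemma fractionalMaximal_add_le (β : ℝ) {G H : Qpn p n → ℝ≥0∞} (hG : Measurable G) (x : Qpn p n) :
    fractionalMaximal β (fun y => G y + H y) x ≤
      fractionalMaximal β G x + fractionalMaximal β H x := by
  refine iSup_le fun γ => ?_
  rw [ballAverage, lintegral_add_left hG, mul_add, mul_add]
  exact add_le_add (le_iSup (fun γ : ℤ => (p : ℝ≥0∞) ^ (γ * β) * ballAverage G γ x) γ)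
    (le_iSup (fun γ : ℤ => (p : ℝ≥0∞) ^ (γ * β) * ballAverage H γ x) γ)

/-- Jensen's inequality, read off from the monotonicity of L^u norms for the normalized measure on
the ball. -/
lemma ballAverage_rpow_le {G : Qpn p n → ℝ≥0∞} (hG : Measurable G) {u : ℝ} (hu : 1 ≤ u) (γ : ℤ)
    (x : Qpn p n) : ballAverage G γ x ^ u ≤ ballAverage (fun y => G y ^ u) γ x := by
  set ν := (haar p n (pBall γ x))⁻¹ • (haar p n).restrict (pBall γ x) with hν
  have hprob : IsProbabilityMeasure ν := ⟨by
    rw [hν, Measure.smul_apply, Measure.restrict_apply_univ, smul_eq_mul,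
      ENNReal.inv_mul_cancel (haar_pBall_ne_zero _ _) (haar_pBall_ne_top _ _)]⟩
  have hav : ∀ H : Qpn p n → ℝ≥0∞, ballAverage H γ x = ∫⁻ y, H y ∂ν := fun H => by
    rw [hν, lintegral_smul_measure, ballAverage, smul_eq_mul]
  have h := eLpNorm'_le_eLpNorm'_of_exponent_le one_pos hu ν hG.aestronglyMeasurable
  rw [eLpNorm', eLpNorm'] at h
  simp only [enorm_eq_self, ENNReal.rpow_one, one_div, inv_one] at h
  rw [hav, hav]
  calc (∫⁻ y, G y ∂ν) ^ u ≤ ((∫⁻ y, G y ^ u ∂ν) ^ u⁻¹) ^ u :=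
        ENNReal.rpow_le_rpow h (by linarith)
    _ = _ := by rw [← ENNReal.rpow_mul, inv_mul_cancel₀ (by linarith), ENNReal.rpow_one]

lemma haar_mul_ballAverage_rpow_le {G : Qpn p n → ℝ≥0∞} (hG : Measurable G) {u : ℝ} (hu : 1 ≤ u)
    (γ : ℤ) (x : Qpn p n) :
    (p : ℝ≥0∞) ^ ((n : ℝ) * γ) * ballAverage G γ x ^ u ≤ ∫⁻ y, G y ^ u ∂(haar p n) := by
  rw [← haar_pBall γ x]
  refine (mul_le_mul_right (ballAverage_rpow_le hG hu γ x) _).trans ?_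
  rw [haar_mul_ballAverage]
  exact setLIntegral_le_lintegral _ _

lemma ballAverage_mono_ae {G H : Qpn p n → ℝ≥0∞} {γ : ℤ} {x : Qpn p n}
    (h : ∀ᵐ y ∂((haar p n).restrict (pBall γ x)), G y ≤ H y) :
    ballAverage G γ x ≤ ballAverage H γ x :=
  mul_le_mul_right (lintegral_mono_ae h) _

lemma iSup_rpow {ι : Sort*} (f : ι → ℝ≥0∞) {q : ℝ} (hq : 0 < q) :
    (⨆ i, f i) ^ q = ⨆ i, f i ^ q := by
  have h := (ENNReal.orderIsoRpow q hq).map_iSup f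
  simp only [ENNReal.orderIsoRpow_apply] at h
  exact h

section KeyEstimates

variable {β s R : ℝ} {r q : Qpn p n → ℝ}

/-- The part of the function that is at least one (where it is not zero). -/
lemma fractionalMaximal_rpow_le_of_large (hn : 1 ≤ n) (hr : IsLogHolder r)
    (hs : 1 < s) (hsr : ∀ y, s ≤ r y) (hrR : ∀ y, r y ≤ R) (hβ0 : 0 < β) (hR : β / n < 1 / R)
    (hq : ∀ y, q y = sobolevExponent (β / n) (r y)) :
    ∃ K : ℝ≥0, ∀ f : Qpn p n → ℝ≥0∞, Measurable f → (∀ y, f y = 0 ∨ 1 ≤ f y) →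
      ∫⁻ y, f y ^ r y ∂(haar p n) ≤ 1 → ∀ᵐ x ∂(haar p n),
        fractionalMaximal β f x ^ q x ≤ K * maximalFunction (fun y => f y ^ (r y / s)) x ^ s := by
  have hp0 := prime_ennreal_ne_zero p
  have hpt := prime_ennreal_ne_top p
  have hp1 := one_le_prime_ennreal p
  have hn0 : (0 : ℝ) < n := by exact_mod_cast hn
  have hs0 : 0 < s := by linarith
  have hα : 0 ≤ β / n := by positivity
  obtain ⟨C, hC, hloc⟩ := hr.exists_local
  set Q := sobolevExponent (β / n) R with hQ
  have hK : (p : ℝ≥0∞) ^ (n * C * Q) ≠ ∞ := ENNReal.rpow_ne_top_of_ne_zero hp0 hpt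
  refine ⟨((p : ℝ≥0∞) ^ (n * C * Q)).toNNReal, fun f hf hf1 hint => ?_⟩
  rw [ENNReal.coe_toNNReal hK]
  -- The point x must satisfy the local condition in all balls B_γ(x) at once.
  have hgood := ae_forall_pBall (P := fun B γ y => essInf r ((haar p n).restrict B) ≤ r y ∧
        -(γ : ℝ) * (r y - essInf r ((haar p n).restrict B)) ≤ C) hloc
  filter_upwards [hgood] with x hx
  have hrx : 0 < r x := hs0.trans_le (hsr x)
  have hqx1 : r x ≤ q x := by
    rw [hq]; exact le_sobolevExponent hα hs0 (hsr x) (hrR x) hR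
  have hqxQ : q x ≤ Q := by
    rw [hq]; exact sobolevExponent_le hs0 (hsr x) (hrR x) hR
  have hqx0 : 0 < q x := hrx.trans_le hqx1
  have hqinv : 1 / q x = 1 / r x - β / n := by
    rw [hq, sobolevExponent, one_div, inv_inv]
  set G : Qpn p n → ℝ≥0∞ := fun y => f y ^ (r y / s) with hG
  have hGm : Measurable G := hf.pow (hr.isExponent.measurable.div_const s)
  rw [fractionalMaximal, iSup_rpow _ hqx0]
  refine iSup_le fun γ => ?_
  obtain ⟨hm1, hm2⟩ := hx γ
  set m := essInf r ((haar p n).restrict (pBall γ x)) with hm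
  have hsm : s ≤ m := (le_essInf_and_essSup_le (haar_restrict_pBall_ne_zero γ x) hsr hrR).1
  have hm0 : 0 < m := hs0.trans_le hsm
  set D := ballAverage G γ x ^ s with hD
  set V := (p : ℝ≥0∞) ^ ((n : ℝ) * γ) with hV
  have hVD : V * D ≤ 1 := by
    refine (haar_mul_ballAverage_rpow_le hGm hs.le γ x).trans ((le_of_eq ?_).trans hint)
    refine lintegral_congr fun y => ?_
    rw [hG, ← ENNReal.rpow_mul, div_mul_cancel₀ _ hs0.ne']
  -- Jensen applies with exponent m/s ≥ 1; as f is 0 or at least 1, raising the exponent from m/s to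
  -- r(y)/s only increases the integrand.
  have hA : ballAverage f γ x ≤ D ^ (1 / m) := by
    have h1 : ballAverage f γ x ^ (m / s) ≤ ballAverage G γ x := by
      refine (ballAverage_rpow_le hf ((one_le_div hs0).2 hsm) γ x).trans (ballAverage_mono_ae ?_)
      filter_upwards [hloc γ x] with y hy
      rcases hf1 y with h0 | h1
      · rw [h0, ENNReal.zero_rpow_of_pos (by positivity)]
        exact zero_le
      · exact ENNReal.rpow_le_rpow_of_exponent_le h1 (by gcongr; exact hy.1)
    have h2 := ENNReal.rpow_le_rpow h1 (show 0 ≤ s / m by positivity)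
    rwa [← ENNReal.rpow_mul, show m / s * (s / m) = 1 by field_simp, ENNReal.rpow_one,
      show s / m = s * (1 / m) by ring, ENNReal.rpow_mul] at h2
  have hexp : 0 ≤ 1 / m - 1 / q x := by
    have := one_div_le_one_div_of_le hm0 (hm1.trans hqx1)
    linarith
  -- Here β/n = 1/r(x) - 1/q(x), and replacing r(x) by the infimum m costs p^(nC) by the local
  -- condition.
  have hVβ : (p : ℝ≥0∞) ^ (γ * β) ≤ V ^ (1 / m - 1 / q x) * (p : ℝ≥0∞) ^ (n * C) := by
    rw [hV, ← ENNReal.rpow_mul, ← ENNReal.rpow_add _ _ hp0 hpt]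
    refine ENNReal.rpow_le_rpow_of_exponent_le hp1 ?_
    have h1 : n * γ * (1 / m - 1 / q x) + n * C =
        γ * β + n * (C - -(γ : ℝ) * (r x - m) / (m * r x)) := by
      rw [hqinv]
      field_simp
      ring
    rw [h1]
    have h2 : -(γ : ℝ) * (r x - m) / (m * r x) ≤ C := by
      rw [div_le_iff₀ (by positivity)]
      refine hm2.trans (le_mul_of_one_le_right hC ?_)
      nlinarith [hsr x]
    have : 0 ≤ n * (C - -(γ : ℝ) * (r x - m) / (m * r x)) :=
      mul_nonneg hn0.le (sub_nonneg.2 h2)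
    linarith
  calc ((p : ℝ≥0∞) ^ (γ * β) * ballAverage f γ x) ^ q x
      ≤ ((p : ℝ≥0∞) ^ (n * C) * D ^ (1 / q x)) ^ q x := by
        refine ENNReal.rpow_le_rpow ?_ hqx0.le
        calc (p : ℝ≥0∞) ^ (γ * β) * ballAverage f γ x
            ≤ (V ^ (1 / m - 1 / q x) * (p : ℝ≥0∞) ^ (n * C)) * D ^ (1 / m) := mul_le_mul' hVβ hA
          -- Hedberg's trick: the surplus power of D pairs with V, and V D ≤ 1.
          _ = (p : ℝ≥0∞) ^ (n * C) * D ^ (1 / q x) * (V * D) ^ (1 / m - 1 / q x) := by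
              rw [ENNReal.mul_rpow_of_nonneg _ _ hexp]
              conv_lhs => rw [show 1 / m = 1 / q x + (1 / m - 1 / q x) by ring,
                ENNReal.rpow_add_of_nonneg _ _ (by positivity) hexp]
              rw [add_sub_cancel_left]
              ring
          _ ≤ (p : ℝ≥0∞) ^ (n * C) * D ^ (1 / q x) * 1 := by
              gcongr
              exact ENNReal.rpow_le_one hVD hexp
          _ = _ := mul_one _
    _ = (p : ℝ≥0∞) ^ (n * C * q x) * D := by
        rw [ENNReal.mul_rpow_of_nonneg _ _ hqx0.le, ← ENNReal.rpow_mul, ← ENNReal.rpow_mul,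
          one_div_mul_cancel hqx0.ne', ENNReal.rpow_one]
    _ ≤ (p : ℝ≥0∞) ^ (n * C * Q) * maximalFunction G x ^ s := by
        refine mul_le_mul' (ENNReal.rpow_le_rpow_of_exponent_le hp1 (by gcongr)) ?_
        exact ENNReal.rpow_le_rpow (ballAverage_le_maximalFunction _ _ _) hs0.le

lemma exists_lintegral_add_decayWeight_rpow_le (hr : Measurable r) (hs : 1 < s) (c : ℝ≥0) :
    ∃ J : ℝ≥0, ∀ f : Qpn p n → ℝ≥0∞, Measurable f → ∫⁻ y, f y ^ r y ∂(haar p n) ≤ 1 →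
      ∫⁻ y, (c * f y ^ (r y / s) + decayWeight y) ^ s ∂(haar p n) ≤ J := by
  have hs0 : 0 < s := by linarith
  set I := ∫⁻ y, decayWeight (p := p) (n := n) y ∂(haar p n) with hI
  have hIt : I ≠ ∞ := lintegral_decayWeight_lt_top.ne
  have hJ : (2 : ℝ≥0∞) ^ (s - 1) * ((c : ℝ≥0∞) ^ s + I) ≠ ∞ :=
    ENNReal.mul_ne_top (ENNReal.rpow_ne_top_of_nonneg (by linarith) (by simp))
      (ENNReal.add_ne_top.2 ⟨ENNReal.rpow_ne_top_of_nonneg hs0.le (by simp), hIt⟩)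
  refine ⟨((2 : ℝ≥0∞) ^ (s - 1) * ((c : ℝ≥0∞) ^ s + I)).toNNReal, fun f hf hint => ?_⟩
  rw [ENNReal.coe_toNNReal hJ]
  calc ∫⁻ y, (c * f y ^ (r y / s) + decayWeight y) ^ s ∂(haar p n)
      ≤ ∫⁻ y, 2 ^ (s - 1) * ((c : ℝ≥0∞) ^ s * f y ^ r y + decayWeight y) ∂(haar p n) := by
        refine lintegral_mono fun y => (ENNReal.rpow_add_le_mul_rpow_add_rpow _ _ hs.le).trans ?_
        refine mul_le_mul_right (add_le_add (le_of_eq ?_) ?_) _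
        · rw [ENNReal.mul_rpow_of_nonneg _ _ hs0.le, ← ENNReal.rpow_mul,
            div_mul_cancel₀ _ hs0.ne']
        · exact (ENNReal.rpow_le_rpow_of_exponent_ge (decayWeight_le_one y) hs.le).trans_eq
            (ENNReal.rpow_one _)
    _ = 2 ^ (s - 1) * ((c : ℝ≥0∞) ^ s * ∫⁻ y, f y ^ r y ∂(haar p n) + I) := by
        rw [lintegral_const_mul' _ _ (ENNReal.rpow_ne_top_of_nonneg (by linarith) (by simp)),
          lintegral_add_right _ measurable_decayWeight, lintegral_const_mul _ (hf.pow hr)]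
    _ ≤ _ := by
        gcongr
        exact mul_le_of_le_one_right' hint

/-- The part of the function that is at most one. -/
lemma fractionalMaximal_rpow_le_of_small (hn : 1 ≤ n) (hr : IsLogHolder r)
    (hs : 1 < s) (hsr : s = essInf r (haar p n)) (hrR : R = essSup r (haar p n)) (hβ0 : 0 < β)
    (hR : β / n < 1 / R) (hq : ∀ y, q y = sobolevExponent (β / n) (r y)) :
    ∃ c K : ℝ≥0, ∀ f : Qpn p n → ℝ≥0∞, Measurable f → (∀ y, f y ≤ 1) →
      ∫⁻ y, f y ^ r y ∂(haar p n) ≤ 1 → ∀ x,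
        fractionalMaximal β f x ^ q x ≤
          K * (maximalFunction (fun y => c * f y ^ (r y / s) + decayWeight y) x ^ s
            + decayWeight x) := by
  have hp0 := prime_ennreal_ne_zero p
  have hpt := prime_ennreal_ne_top p
  have hp1 := one_le_prime_ennreal p
  have hn0 : (0 : ℝ) < n := by exact_mod_cast hn
  have hs0 : 0 < s := by linarith
  have hα : 0 ≤ β / n := by positivity
  obtain ⟨C, hC, r₀, hr₀1, hr₀2, hr₀⟩ := hr.exists_atInfinity hn
  have hslo : ∀ y, s ≤ r y := fun y => hsr ▸ hr.isExponent.essInf_le y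
  have hhi : ∀ y, r y ≤ R := fun y => hrR ▸ hr.isExponent.le_essSup y
  rw [← hsr] at hr₀1
  rw [← hrR] at hr₀2
  set q₀ := sobolevExponent (β / n) r₀ with hq₀
  set Q := sobolevExponent (β / n) R with hQ
  have hr₀0 : 0 < r₀ := hs0.trans_le hr₀1
  have hrq₀ : r₀ ≤ q₀ := le_sobolevExponent hα hs0 hr₀1 hr₀2 hR
  have hsq₀ : s ≤ q₀ := hr₀1.trans hrq₀
  have hq₀0 : 0 < q₀ := hs0.trans_le hsq₀
  have hq₀Q : q₀ ≤ Q := sobolevExponent_le hs0 hr₀1 hr₀2 hR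
  have hQ0 : 0 < Q := hq₀0.trans_le hq₀Q
  have hq₀inv : 1 / r₀ = β / n + 1 / q₀ := by
    rw [hq₀, sobolevExponent, one_div, one_div, inv_inv]
    ring
  -- The denominator 1 is the lower bound for the exponent r₀/s in the comparison used for `hA`.
  set c : ℝ≥0 := (p : ℝ≥0) ^ ((n + 1) * C / 1) with hc
  have hc' : (c : ℝ≥0∞) = (p : ℝ≥0∞) ^ ((n + 1) * C / 1) := by
    rw [hc, ENNReal.coe_rpow_of_nonneg _ (by positivity), ENNReal.coe_natCast]
  obtain ⟨J, hJ⟩ := exists_lintegral_add_decayWeight_rpow_le hr.isExponent.measurable hs c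
  set L := Q ^ 2 with hL
  -- Here s/Q is a lower bound for q(x)/q₀, and L is the Lipschitz constant of the Sobolev exponent.
  set c₂ : ℝ≥0∞ := (p : ℝ≥0∞) ^ ((n + 1) * (L * C) / (s / Q)) with hc₂
  have hc₂1 : 1 ≤ c₂ := by
    rw [hc₂]
    exact ENNReal.rpow_zero.symm.trans_le
      (ENNReal.rpow_le_rpow_of_exponent_le hp1 (by positivity))
  set J₁ : ℝ≥0∞ := (J : ℝ≥0∞) + 1 with hJ₁
  have hJ₁1 : 1 ≤ J₁ := le_add_self
  set K₂ : ℝ≥0∞ := ((c : ℝ≥0∞) + 1) ^ s with hK₂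
  have hK₂1 : 1 ≤ K₂ := by
    rw [hK₂]
    exact (ENNReal.one_rpow s).symm.trans_le (ENNReal.rpow_le_rpow le_add_self hs0.le)
  have hK₂t : K₂ ≠ ∞ := ENNReal.rpow_ne_top_of_nonneg hs0.le (by simp)
  have hKt : J₁ ^ (β / n * Q) * (K₂ ^ (Q / s) * c₂) ≠ ∞ :=
    ENNReal.mul_ne_top (ENNReal.rpow_ne_top_of_nonneg (by positivity) (by simp [hJ₁]))
      (ENNReal.mul_ne_top (ENNReal.rpow_ne_top_of_nonneg (by positivity) hK₂t)
        (ENNReal.rpow_ne_top_of_ne_zero hp0 hpt))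
  refine ⟨c, (J₁ ^ (β / n * Q) * (K₂ ^ (Q / s) * c₂)).toNNReal, fun f hf hf1 hint x => ?_⟩
  rw [ENNReal.coe_toNNReal hKt]
  have hqx1 : r x ≤ q x := by
    rw [hq]; exact le_sobolevExponent hα hs0 (hslo x) (hhi x) hR
  have hqxQ : q x ≤ Q := by
    rw [hq]; exact sobolevExponent_le hs0 (hslo x) (hhi x) hR
  have hsq : s ≤ q x := (hslo x).trans hqx1
  have hqx0 : 0 < q x := hs0.trans_le hsq
  set H : Qpn p n → ℝ≥0∞ := fun y => c * f y ^ (r y / s) + decayWeight y with hH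
  have hHm : Measurable H :=
    ((hf.pow (hr.isExponent.measurable.div_const s)).const_mul _).add measurable_decayWeight
  have hHle : ∀ y, H y ≤ (c : ℝ≥0∞) + 1 := fun y => by
    refine add_le_add (mul_le_of_le_one_right' ?_) (decayWeight_le_one y)
    exact ENNReal.rpow_le_one (hf1 y) (div_nonneg (hs0.le.trans (hslo y)) hs0.le)
  rw [fractionalMaximal, iSup_rpow _ hqx0]
  refine iSup_le fun γ => ?_
  set D := ballAverage H γ x ^ s with hD
  set V := (p : ℝ≥0∞) ^ ((n : ℝ) * γ) with hV
  have hVD : V * D ≤ J₁ :=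
    ((haar_mul_ballAverage_rpow_le hHm hs.le γ x).trans (hJ f hf hint)).trans le_self_add
  have hDK : D ≤ K₂ := by
    refine ENNReal.rpow_le_rpow ((ballAverage_mono hHle γ x).trans_eq ?_) hs0.le
    exact ballAverage_const _ _ _
  have hA : ballAverage f γ x ≤ D ^ (1 / r₀) := by
    have h1 : ballAverage f γ x ^ (r₀ / s) ≤ ballAverage H γ x := by
      refine (ballAverage_rpow_le hf ((one_le_div hs0).2 hr₀1) γ x).trans
        (ballAverage_mono (fun y => ?_) γ x)
      rw [hH]
      beta_reduce
      rw [hc']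
      refine rpow_le_mul_rpow_add_decayWeight (hf1 y) one_pos ((one_le_div hs0).2 hr₀1) hC y ?_
      rw [← sub_div, abs_div, abs_of_pos hs0, abs_sub_comm]
      exact (div_le_self (abs_nonneg _) hs.le).trans (hr₀ y)
    have h2 := ENNReal.rpow_le_rpow h1 (show 0 ≤ s / r₀ by positivity)
    rwa [← ENNReal.rpow_mul, show r₀ / s * (s / r₀) = 1 by field_simp, ENNReal.rpow_one,
      show s / r₀ = s * (1 / r₀) by ring, ENNReal.rpow_mul] at h2
  -- The comparison of exponents q(x)/q₀ and 1 needs a base at most one, so D is first divided by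
  -- its bound K₂.
  have hpow : D ^ (q x / q₀) ≤ K₂ ^ (Q / s) * (c₂ * (D + decayWeight x)) := by
    have hK₂0 : K₂ ≠ 0 := (one_pos.trans_le hK₂1).ne'
    have ht1 : D / K₂ ≤ 1 := ENNReal.div_le_of_le_mul (by rwa [one_mul])
    have hDt : D = K₂ * (D / K₂) := (ENNReal.mul_div_cancel hK₂0 hK₂t).symm
    have ha : 0 ≤ q x / q₀ := by positivity
    have h1 : (D / K₂) ^ (q x / q₀) ≤ c₂ * (D / K₂) ^ (1 : ℝ) + decayWeight x := by
      refine rpow_le_mul_rpow_add_decayWeight ht1 (by positivity) ?_ (by positivity) x ?_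
      · gcongr
      · rw [show q x / q₀ - 1 = (q x - q₀) / q₀ by field_simp, abs_div, abs_of_pos hq₀0]
        refine (div_le_self (abs_nonneg _) (hs.le.trans hsq₀)).trans ?_
        rw [hq, hq₀]
        refine (abs_sobolevExponent_sub_le hs.le (hslo x) (hhi x) hr₀1 hr₀2 hR).trans ?_
        rw [mul_div_assoc]
        exact mul_le_mul_of_nonneg_left (hr₀ x) (by positivity)
    rw [ENNReal.rpow_one] at h1
    have h2 : D / K₂ ≤ D := ENNReal.div_le_of_le_mul (le_mul_of_one_le_right' hK₂1)
    calc D ^ (q x / q₀) = K₂ ^ (q x / q₀) * (D / K₂) ^ (q x / q₀) := by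
          rw [← ENNReal.mul_rpow_of_nonneg _ _ ha, ← hDt]
      _ ≤ K₂ ^ (Q / s) * (c₂ * D + c₂ * decayWeight x) := by
          refine mul_le_mul' (ENNReal.rpow_le_rpow_of_exponent_le hK₂1 (by gcongr)) ?_
          exact h1.trans (add_le_add (mul_le_mul_right h2 _) (le_mul_of_one_le_left' hc₂1))
      _ = _ := by rw [mul_add c₂]
  calc ((p : ℝ≥0∞) ^ (γ * β) * ballAverage f γ x) ^ q x
      ≤ (J₁ ^ (β / n) * D ^ (1 / q₀)) ^ q x := by
        refine ENNReal.rpow_le_rpow ?_ hqx0.le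
        have hVβ : (p : ℝ≥0∞) ^ (γ * β) = V ^ (β / n) := by
          rw [hV, ← ENNReal.rpow_mul]
          congr 1
          field_simp
        calc (p : ℝ≥0∞) ^ (γ * β) * ballAverage f γ x
            ≤ V ^ (β / n) * D ^ (1 / r₀) := mul_le_mul' hVβ.le hA
          _ = (V * D) ^ (β / n) * D ^ (1 / q₀) := by
              rw [hq₀inv, ENNReal.rpow_add_of_nonneg _ _ hα (by positivity),
                ENNReal.mul_rpow_of_nonneg _ _ hα, mul_assoc]
          _ ≤ _ := by gcongr
    _ = J₁ ^ (β / n * q x) * D ^ (q x / q₀) := by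
        rw [ENNReal.mul_rpow_of_nonneg _ _ hqx0.le, ← ENNReal.rpow_mul, ← ENNReal.rpow_mul,
          one_div_mul_eq_div]
    _ ≤ J₁ ^ (β / n * Q) * (K₂ ^ (Q / s) * (c₂ * (D + decayWeight x))) :=
        mul_le_mul' (ENNReal.rpow_le_rpow_of_exponent_le hJ₁1 (by gcongr)) hpow
    _ = J₁ ^ (β / n * Q) * (K₂ ^ (Q / s) * c₂) * (D + decayWeight x) := by ring
    _ ≤ _ := by
        refine mul_le_mul_right (add_le_add_left ?_ _) _
        exact ENNReal.rpow_le_rpow (ballAverage_le_maximalFunction _ _ _) hs0.le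

/-- The modular inequality for the fractional maximal operator. -/
theorem exists_lintegral_fractionalMaximal_rpow_le (hn : 1 ≤ n) (hr : IsLogHolder r) (hβ0 : 0 < β)
    (hR : β / n < 1 / essSup r (haar p n)) (hq : ∀ y, q y = sobolevExponent (β / n) (r y)) :
    ∃ K : ℝ≥0, ∀ f : Qpn p n → ℝ≥0∞, Measurable f → (∀ y, f y ≠ ∞) →
      ∫⁻ y, f y ^ r y ∂(haar p n) ≤ 1 →
      ∫⁻ x, fractionalMaximal β f x ^ q x ∂(haar p n) ≤ K := by
  have hs := hr.isExponent.one_lt_essInf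
  set s := essInf r (haar p n) with hsr
  set R := essSup r (haar p n) with hRr
  have hs0 : 0 < s := by linarith
  have hslo : ∀ y, s ≤ r y := hr.isExponent.essInf_le
  have hhi : ∀ y, r y ≤ R := hr.isExponent.le_essSup
  have hrm := hr.isExponent.measurable
  have hn0 : (0 : ℝ) < n := by exact_mod_cast hn
  have hα : 0 ≤ β / n := by positivity
  set Q := sobolevExponent (β / n) R with hQ
  obtain ⟨K₁, hK₁⟩ := fractionalMaximal_rpow_le_of_large hn hr hs hslo hhi hβ0 hR hq
  obtain ⟨c, K₂, hK₂⟩ := fractionalMaximal_rpow_le_of_small hn hr hs hsr hRr hβ0 hR hq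
  obtain ⟨J, hJ⟩ := exists_lintegral_add_decayWeight_rpow_le hrm hs c
  obtain ⟨M, hM⟩ := lintegral_maximalFunction_rpow_le (p := p) hn hs
  set I := ∫⁻ y, decayWeight (p := p) (n := n) y ∂(haar p n) with hI
  have hIt : I ≠ ∞ := lintegral_decayWeight_lt_top.ne
  set K : ℝ≥0∞ := 2 ^ Q * (K₁ * M + K₂ * (M * J + I)) with hK
  have hKt : K ≠ ∞ := by
    refine ENNReal.mul_ne_top (ENNReal.rpow_ne_top_of_ne_zero (by simp) (by simp)) ?_
    exact ENNReal.add_ne_top.2 ⟨ENNReal.mul_ne_top (by simp) (by simp),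
      ENNReal.mul_ne_top (by simp)
        (ENNReal.add_ne_top.2 ⟨ENNReal.mul_ne_top (by simp) (by simp), hIt⟩)⟩
  refine ⟨K.toNNReal, fun f hf hft hint => ?_⟩
  rw [ENNReal.coe_toNNReal hKt]
  have hS : MeasurableSet {y | 1 ≤ f y} := measurableSet_le measurable_const hf
  -- The splitting at height one makes powers of f₁ increase and powers of f₂ decrease with the
  -- exponent.
  set f₁ := {y | 1 ≤ f y}.indicator f with hf₁
  set f₂ := {y | 1 ≤ f y}ᶜ.indicator f with hf₂
  have hf₁m : Measurable f₁ := hf.indicator hS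
  have hf₂m : Measurable f₂ := hf.indicator hS.compl
  have hsum : f = fun y => f₁ y + f₂ y := by
    funext y
    exact (congrFun (indicator_self_add_compl {y | 1 ≤ f y} f) y).symm
  have hle₁ : ∀ y, f₁ y ≤ f y := fun y => indicator_le_self _ _ y
  have hle₂ : ∀ y, f₂ y ≤ f y := fun y => indicator_le_self _ _ y
  have hint' : ∀ g : Qpn p n → ℝ≥0∞, (∀ y, g y ≤ f y) → ∫⁻ y, g y ^ r y ∂(haar p n) ≤ 1 :=
    fun g hg => (lintegral_mono fun y =>
      ENNReal.rpow_le_rpow (hg y) (hs0.le.trans (hslo y))).trans hint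
  have hfin : ∀ g : Qpn p n → ℝ≥0∞, (∀ y, g y ≤ f y) → ∀ y, g y ^ (r y / s) ≠ ∞ :=
    fun g hg y => ENNReal.rpow_ne_top_of_nonneg (div_nonneg (hs0.le.trans (hslo y)) hs0.le)
      ((hg y).trans_lt (hft y).lt_top).ne
  have h₁ := hK₁ f₁ hf₁m (fun y => by
    by_cases hy : y ∈ {y | 1 ≤ f y}
    · right; rw [hf₁, indicator_of_mem hy]; exact hy
    · left; rw [hf₁, indicator_of_notMem hy]) (hint' f₁ hle₁)
  have h₂ := hK₂ f₂ hf₂m (fun y => by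
    by_cases hy : y ∈ {y | 1 ≤ f y}
    · rw [hf₂, indicator_of_notMem (by simpa using hy)]; exact zero_le
    · rw [hf₂, indicator_of_mem hy]; exact (not_le.1 hy).le) (hint' f₂ hle₂)
  set G := fun y => f₁ y ^ (r y / s) with hG
  set H := fun y => c * f₂ y ^ (r y / s) + decayWeight y with hH
  have hGm : Measurable G := hf₁m.pow (hrm.div_const s)
  have hHm : Measurable H :=
    ((hf₂m.pow (hrm.div_const s)).const_mul _).add measurable_decayWeight
  have hGint : ∫⁻ x, maximalFunction G x ^ s ∂(haar p n) ≤ M := by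
    refine (hM G hGm (hfin f₁ hle₁)).trans (mul_le_of_le_one_right' ?_)
    refine (le_of_eq (lintegral_congr fun y => ?_)).trans (hint' f₁ hle₁)
    rw [hG, ← ENNReal.rpow_mul, div_mul_cancel₀ _ hs0.ne']
  have hHint : ∫⁻ x, maximalFunction H x ^ s ∂(haar p n) ≤ M * J := by
    refine (hM H hHm fun y => ENNReal.add_ne_top.2 ⟨ENNReal.mul_ne_top (by simp)
      (hfin f₂ hle₂ y), ((decayWeight_le_one y).trans_lt ENNReal.one_lt_top).ne⟩).trans ?_
    exact mul_le_mul_right (hJ f₂ hf₂m (hint' f₂ hle₂)) _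
  have hGM := (measurable_maximalFunction hGm).pow_const s
  have hHM := (measurable_maximalFunction hHm).pow_const s
  calc ∫⁻ x, fractionalMaximal β f x ^ q x ∂(haar p n)
      ≤ ∫⁻ x, 2 ^ Q * (K₁ * maximalFunction G x ^ s +
          K₂ * (maximalFunction H x ^ s + decayWeight x)) ∂(haar p n) := by
        refine lintegral_mono_ae (h₁.mono fun x hx => ?_)
        have hqx1 : r x ≤ q x := by
          rw [hq]; exact le_sobolevExponent hα hs0 (hslo x) (hhi x) hR
        have hqxQ : q x ≤ Q := by
          rw [hq]; exact sobolevExponent_le hs0 (hslo x) (hhi x) hR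
        have hq1 : 1 ≤ q x := hs.le.trans ((hslo x).trans hqx1)
        have hadd : fractionalMaximal β f x ≤
            fractionalMaximal β f₁ x + fractionalMaximal β f₂ x := by
          conv_lhs => rw [hsum]
          exact fractionalMaximal_add_le β hf₁m x
        refine (ENNReal.rpow_le_rpow hadd (by linarith)).trans
          ((ENNReal.rpow_add_le_mul_rpow_add_rpow _ _ hq1).trans ?_)
        refine mul_le_mul' (ENNReal.rpow_le_rpow_of_exponent_le (by norm_num) (by linarith)) ?_
        exact add_le_add hx (h₂ x)
    _ = 2 ^ Q * (K₁ * ∫⁻ x, maximalFunction G x ^ s ∂(haar p n) +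
          K₂ * (∫⁻ x, maximalFunction H x ^ s ∂(haar p n) + I)) := by
        rw [lintegral_const_mul' _ _ (ENNReal.rpow_ne_top_of_ne_zero (by simp) (by simp)),
          lintegral_add_left (hGM.const_mul _), lintegral_const_mul _ hGM,
          lintegral_const_mul' _ _ ENNReal.coe_ne_top, lintegral_add_left hHM]
    _ ≤ K := by rw [hK]; gcongr

end KeyEstimates

/-! ### Luxemburg norms and modulars -/

section LuxemburgNorm

variable {ε ε' : Type*} [TopologicalSpace ε] [ContinuousENorm ε] [TopologicalSpace ε']
  [ContinuousENorm ε'] {q r : Qpn p n → ℝ} {f : Qpn p n → ε} {g : Qpn p n → ε'}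

lemma luxNorm_le {η : ℝ≥0} (hη : 0 < η) (h : modular q f η ≤ 1) : luxNorm q f ≤ η :=
  iInf₂_le η ⟨hη, h⟩

lemma exists_modular_le_one_of_luxNorm_lt {c : ℝ≥0∞} (h : luxNorm q f < c) :
    ∃ η : ℝ≥0, 0 < η ∧ modular q f η ≤ 1 ∧ (η : ℝ≥0∞) < c := by
  obtain ⟨η, h⟩ := iInf_lt_iff.1 h
  obtain ⟨⟨h1, h2⟩, h3⟩ := iInf_lt_iff.1 h
  exact ⟨η, h1, h2, h3⟩

/-- Since q ≥ 1, the factor k^(-q(x)) is at most k⁻¹. This converts any uniform modular bound into a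
norm bound. -/
lemma modular_mul_le (hq : ∀ x, 1 ≤ q x) {k : ℝ≥0} (hk : 1 ≤ k) (η : ℝ≥0) :
    modular q f (k * η) ≤ (k : ℝ≥0∞)⁻¹ * modular q f η := by
  have hk0 : (k : ℝ≥0∞) ≠ 0 := by exact_mod_cast (one_pos.trans_le hk).ne'
  rw [modular, modular, ← lintegral_const_mul' _ _ (ENNReal.inv_ne_top.2 hk0)]
  refine lintegral_mono fun x => ?_
  have hk' : (k : ℝ≥0∞)⁻¹ ≤ 1 := ENNReal.inv_le_one.2 (by exact_mod_cast hk)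
  have hqx : 0 ≤ q x := zero_le_one.trans (hq x)
  rw [ENNReal.coe_mul, div_eq_mul_inv, ENNReal.mul_inv (Or.inl hk0) (Or.inl ENNReal.coe_ne_top),
    mul_left_comm, ← div_eq_mul_inv, ENNReal.mul_rpow_of_nonneg _ _ hqx]
  refine mul_le_mul_left ?_ _
  exact (ENNReal.rpow_le_rpow_of_exponent_ge hk' (hq x)).trans_eq (ENNReal.rpow_one _)

lemma modular_mul_le_one (hq : ∀ x, 1 ≤ q x) {k η : ℝ≥0} (h : modular q f η ≤ k) :
    modular q f (max 1 k * η) ≤ 1 := by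
  refine (modular_mul_le hq (le_max_left 1 k) η).trans ?_
  have h0 : ((max 1 k : ℝ≥0) : ℝ≥0∞) ≠ 0 := by
    exact_mod_cast (one_pos.trans_le (le_max_left 1 k)).ne'
  rw [← ENNReal.div_eq_inv_mul]
  refine ENNReal.div_le_of_le_mul ?_
  rw [one_mul]
  exact h.trans (by exact_mod_cast le_max_right 1 k)

lemma MemLvar.exists_modular_le_one (hq : ∀ x, 1 ≤ q x) (hf : MemLvar q f) :
    ∃ η : ℝ≥0, 0 < η ∧ modular q f η ≤ 1 := by
  obtain ⟨-, η, hη, h⟩ := hf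
  refine ⟨max 1 (modular q f η).toNNReal * η,
    mul_pos (one_pos.trans_le (le_max_left _ _)) hη, modular_mul_le_one hq ?_⟩
  rw [ENNReal.coe_toNNReal h.ne]

lemma luxNorm_le_mul {C : ℝ≥0} (hC : 0 < C)
    (h : ∀ η : ℝ≥0, 0 < η → modular r g η ≤ 1 → modular q f (C * η) ≤ 1) :
    luxNorm q f ≤ C * luxNorm r g := by
  have hC0 : (C : ℝ≥0∞) ≠ 0 := by exact_mod_cast hC.ne'
  rw [luxNorm.eq_1 (f := g), ENNReal.mul_iInf_of_ne hC0 ENNReal.coe_ne_top]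
  refine le_iInf fun η => ?_
  rw [ENNReal.mul_iInf_of_ne hC0 ENNReal.coe_ne_top]
  refine le_iInf fun hη => (luxNorm_le (mul_pos hC hη.1) (h η hη.1 hη.2)).trans (le_of_eq ?_)
  rw [ENNReal.coe_mul]

lemma luxNorm_le_mul_of_enorm_le (hq : ∀ x, 0 ≤ q x) {C : ℝ≥0} (hC : 0 < C)
    (h : ∀ᵐ x ∂(haar p n), ‖f x‖ₑ ≤ C * ‖g x‖ₑ) : luxNorm q f ≤ C * luxNorm q g := by
  have hC0 : (C : ℝ≥0∞) ≠ 0 := by exact_mod_cast hC.ne'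
  refine luxNorm_le_mul hC fun η hη hm => le_trans (lintegral_mono_ae ?_) hm
  filter_upwards [h] with x hx
  refine ENNReal.rpow_le_rpow ?_ (hq x)
  rw [ENNReal.coe_mul]
  calc ‖f x‖ₑ / (C * η) ≤ C * ‖g x‖ₑ / (C * η) := by gcongr
    _ = _ := ENNReal.mul_div_mul_left _ _ hC0 ENNReal.coe_ne_top

end LuxemburgNorm

section Admissible

variable {β : ℝ} {r q : Qpn p n → ℝ}

lemma AdmissiblePair.div_lt (h : AdmissiblePair β r q) (hn : 1 ≤ n) (hβ : 0 < β) :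
    β / n < 1 / essSup r (haar p n) := by
  have hn0 : (0 : ℝ) < n := by exact_mod_cast hn
  have h1 : 0 < essSup r (haar p n) :=
    (one_pos.trans h.logHolder_r.isExponent.one_lt_essInf).trans_le
      ((h.logHolder_r.isExponent.essInf_le 0).trans (h.logHolder_r.isExponent.le_essSup 0))
  have h2 := h.essSup_lt
  rw [lt_div_iff₀ hβ] at h2
  rw [div_lt_div_iff₀ hn0 h1]
  linarith

lemma AdmissiblePair.eq_sobolevExponent (h : AdmissiblePair β r q) (y : Qpn p n) :
    q y = sobolevExponent (β / n) (r y) := by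
  rw [sobolevExponent, ← h.one_div_eq y, one_div, inv_inv]

lemma IsExponent.one_le (h : IsExponent q) (y : Qpn p n) : 1 ≤ q y :=
  h.one_lt_essInf.le.trans (h.essInf_le y)

end Admissible

lemma haar_inv_mul_lintegral_pBall (G : Qpn p n → ℝ≥0∞) (γ : ℤ) (x : Qpn p n) :
    (haar p n (pBall γ x))⁻¹ * ∫⁻ y in pBall γ x, G y ∂(haar p n) = ballAverage G γ x := rfl

/-- With c = b(y) and y in the ball, the right-hand side is one of the averages defining the
commutator of the indicator function. -/
lemma enorm_sub_setAverage_le {b : Qpn p n → ℝ} (hb : LocallyIntegrable b (haar p n)) (c : ℝ)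
    (γ : ℤ) (a : Qpn p n) :
    ‖c - ⨍ z in pBall γ a, b z ∂(haar p n)‖ₑ ≤ ballAverage (fun z => ‖c - b z‖ₑ) γ a := by
  have hint : IntegrableOn b (pBall γ a) (haar p n) :=
    hb.integrableOn_isCompact (isCompact_closedBall _ _)
  set ν := (haar p n (pBall γ a))⁻¹ • (haar p n).restrict (pBall γ a) with hν
  have hprob : IsProbabilityMeasure ν := ⟨by
    rw [hν, Measure.smul_apply, Measure.restrict_apply_univ, smul_eq_mul,
      ENNReal.inv_mul_cancel (haar_pBall_ne_zero _ _) (haar_pBall_ne_top _ _)]⟩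
  have hint' : Integrable b ν :=
    hint.smul_measure (ENNReal.inv_ne_top.2 (haar_pBall_ne_zero γ a))
  have h1 : c - ⨍ z in pBall γ a, b z ∂(haar p n) = ∫ z, (c - b z) ∂ν := by
    rw [integral_sub (integrable_const c) hint', integral_const, average,
      Measure.restrict_apply_univ,
      probReal_univ, one_smul]
  rw [h1]
  refine (enorm_integral_le_lintegral_enorm _).trans (le_of_eq ?_)
  rw [hν, lintegral_smul_measure, ballAverage, smul_eq_mul]

/-! ### Consequences of the Lipschitz condition -/

section Lipschitz

variable {β : ℝ} {b : Qpn p n → ℝ}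

lemma enorm_sub_le_of_mem_pBall (hβ : 0 < β) {x y : Qpn p n} {γ : ℤ} (h : y ∈ pBall γ x) :
    ‖b x - b y‖ₑ ≤ lipNorm β b * (p : ℝ≥0∞) ^ (γ * β) := by
  rcases eq_or_ne x y with rfl | hxy
  · simp
  have h0 : ‖x - y‖ₑ ≠ 0 := by simpa [sub_eq_zero] using hxy
  have h1 : ‖b x - b y‖ₑ / ‖x - y‖ₑ ^ β ≤ lipNorm β b :=
    le_iSup_of_le x (le_iSup_of_le y (le_iSup_of_le hxy le_rfl))
  have hpos : 0 < ‖x - y‖ₑ ^ β := ENNReal.rpow_pos (pos_iff_ne_zero.2 h0) enorm_ne_top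
  rw [ENNReal.div_le_iff hpos.ne' (ENNReal.rpow_ne_top_of_nonneg hβ.le enorm_ne_top)] at h1
  refine h1.trans (mul_le_mul_right ?_ _)
  rw [ENNReal.rpow_mul]
  refine ENNReal.rpow_le_rpow ?_ hβ.le
  rw [mem_pBall, norm_sub_rev] at h
  rw [← ofReal_norm]
  refine (ENNReal.ofReal_le_ofReal h).trans (le_of_eq ?_)
  rw [← Real.rpow_intCast, ← ENNReal.ofReal_rpow_of_pos (prime_real_pos p), ENNReal.ofReal_natCast]

lemma ballAverage_const_mul {c : ℝ≥0∞} (hc : c ≠ ∞) (G : Qpn p n → ℝ≥0∞) (γ : ℤ) (x : Qpn p n) :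
    ballAverage (fun y => c * G y) γ x = c * ballAverage G γ x := by
  rw [ballAverage, lintegral_const_mul' _ _ hc, mul_left_comm, ballAverage]

/-- Values b(y) enter only under an integral, so g may replace b there; the outer value b(x) is not
averaged, so agreement at x is required. -/
lemma maximalCommutator_le (hβ : 0 < β) {g f : Qpn p n → ℝ} (hgb : g =ᵐ[haar p n] b)
    (hlip : lipNorm β g ≠ ∞) {x : Qpn p n} (hx : g x = b x) :
    maximalCommutator b f x ≤ lipNorm β g * fractionalMaximal β (fun y => ‖f y‖ₑ) x := by
  refine iSup_le fun γ => ?_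
  rw [haar_inv_mul_lintegral_pBall]
  calc ballAverage (fun y => ‖b x - b y‖ₑ * ‖f y‖ₑ) γ x
      ≤ ballAverage (fun y => lipNorm β g * (p : ℝ≥0∞) ^ (γ * β) * ‖f y‖ₑ) γ x := by
        refine ballAverage_mono_ae ?_
        filter_upwards [ae_restrict_of_ae hgb, ae_restrict_mem (measurableSet_pBall γ x)]
          with y hy hmem
        rw [← hx, ← hy]
        exact mul_le_mul_left (enorm_sub_le_of_mem_pBall hβ hmem) _
    _ = lipNorm β g * ((p : ℝ≥0∞) ^ (γ * β) * ballAverage (fun y => ‖f y‖ₑ) γ x) := by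
        rw [ballAverage_const_mul (ENNReal.mul_ne_top hlip (ENNReal.rpow_ne_top_of_ne_zero
          (prime_ennreal_ne_zero p) (prime_ennreal_ne_top p))), mul_assoc]
    _ ≤ _ := mul_le_mul_right
        (le_iSup (fun γ : ℤ => (p : ℝ≥0∞) ^ (γ * β) * ballAverage (fun y => ‖f y‖ₑ) γ x) γ) _

lemma fractionalMaximal_const_mul {c : ℝ≥0∞} (hc : c ≠ ∞) (G : Qpn p n → ℝ≥0∞) (x : Qpn p n) :
    fractionalMaximal β (fun y => c * G y) x = c * fractionalMaximal β G x := by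
  simp_rw [fractionalMaximal, ballAverage_const_mul hc, mul_left_comm _ c, ENNReal.mul_iSup]

lemma fractionalMaximal_congr_ae {G H : Qpn p n → ℝ≥0∞} (h : G =ᵐ[haar p n] H) :
    fractionalMaximal β G = fractionalMaximal β H := by
  funext x
  refine iSup_congr fun γ => ?_
  rw [ballAverage, lintegral_congr_ae (ae_restrict_of_ae h), ballAverage]

lemma aemeasurable_maximalCommutator {f : Qpn p n → ℝ} (hb : AEMeasurable b (haar p n))
    (hf : AEMeasurable f (haar p n)) : AEMeasurable (maximalCommutator b f) (haar p n) := by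
  have hm : Measurable (maximalCommutator (hb.mk b) (hf.mk f)) := by
    refine Measurable.iSup fun γ => ?_
    simp_rw [haar_pBall]
    refine (measurable_lintegral_pBall (F := fun x y => ‖hb.mk b x - hb.mk b y‖ₑ * ‖hf.mk f y‖ₑ)
      ?_ γ).const_mul _
    have h1 := hb.measurable_mk
    have h2 := hf.measurable_mk
    exact (((h1.comp measurable_fst).sub (h1.comp measurable_snd)).enorm).mul
      (h2.comp measurable_snd).enorm
  refine ⟨_, hm, ?_⟩
  filter_upwards [hb.ae_eq_mk] with x hx
  refine iSup_congr fun γ => ?_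
  congr 1
  refine lintegral_congr_ae ?_
  filter_upwards [ae_restrict_of_ae hb.ae_eq_mk, ae_restrict_of_ae hf.ae_eq_mk] with y h1 h2
  rw [hx, h1, h2]

theorem MemLipschitz.commutatorBounded (hn : 1 ≤ n) (hβ : 0 < β)
    (hb : LocallyIntegrable b (haar p n)) (h : MemLipschitz β b) {r q : Qpn p n → ℝ}
    (hrq : AdmissiblePair β r q) : CommutatorBounded b r q := by
  obtain ⟨g, hg, hgb, hlip⟩ := h
  obtain ⟨K, hK⟩ := exists_lintegral_fractionalMaximal_rpow_le hn hrq.logHolder_r hβ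
    (hrq.div_lt hn hβ) hrq.eq_sobolevExponent
  have hr1 := hrq.logHolder_r.isExponent.one_le
  have hq1 := hrq.logHolder_q.isExponent.one_le
  -- The maximum with 1 keeps Λ positive even if the seminorm vanishes, as scaling the norm
  -- requires.
  set Λ : ℝ≥0 := max 1 (lipNorm β g).toNNReal with hΛ
  have hΛ0 : 0 < Λ := one_pos.trans_le (le_max_left _ _)
  have hlipΛ : lipNorm β g ≤ Λ := by
    rw [← ENNReal.coe_toNNReal hlip.ne]
    exact_mod_cast le_max_right _ _
  have hmain : ∀ f : Qpn p n → ℝ, MemLvar r f → ∀ η : ℝ≥0, 0 < η → modular r f η ≤ 1 →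
      modular q (maximalCommutator b f) (Λ * η) ≤ K := by
    intro f hf η hη hmod
    have hη0 : (η : ℝ≥0∞) ≠ 0 := by exact_mod_cast hη.ne'
    have hfm := hf.1.aemeasurable
    set F : Qpn p n → ℝ≥0∞ := fun y => ‖hfm.mk f y‖ₑ / η with hF
    have hFm : Measurable F := hfm.measurable_mk.enorm.div_const _
    have hFint : ∫⁻ y, F y ^ r y ∂(haar p n) ≤ 1 := by
      refine (le_of_eq (lintegral_congr_ae ?_)).trans hmod
      filter_upwards [hfm.ae_eq_mk] with y hy
      rw [hF, hy]
    have hFf : (fun y => ‖f y‖ₑ) =ᵐ[haar p n] fun y => η * F y := by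
      filter_upwards [hfm.ae_eq_mk] with y hy
      rw [hF, hy, ENNReal.mul_div_cancel hη0 ENNReal.coe_ne_top]
    refine le_trans (lintegral_mono_ae ?_)
      (hK F hFm (fun y => ENNReal.div_ne_top enorm_ne_top hη0) hFint)
    filter_upwards [hgb] with x hx
    refine ENNReal.rpow_le_rpow ?_ (zero_le_one.trans (hq1 x))
    rw [enorm_eq_self]
    refine ENNReal.div_le_of_le_mul ?_
    have h1 := maximalCommutator_le (f := f) hβ hgb hlip.ne hx
    rw [fractionalMaximal_congr_ae hFf, fractionalMaximal_const_mul ENNReal.coe_ne_top] at h1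
    refine h1.trans ((mul_le_mul_left hlipΛ _).trans (le_of_eq ?_))
    rw [ENNReal.coe_mul]
    ring
  refine ⟨max 1 K * Λ, fun f hf => ⟨⟨?_, ?_⟩, ?_⟩⟩
  · exact (aemeasurable_maximalCommutator hb.aestronglyMeasurable.aemeasurable
      hf.1.aemeasurable).aestronglyMeasurable
  · obtain ⟨η, hη, hmod⟩ := hf.exists_modular_le_one hr1
    exact ⟨Λ * η, mul_pos hΛ0 hη, (hmain f hf η hη hmod).trans_lt ENNReal.coe_lt_top⟩
  · refine luxNorm_le_mul (mul_pos (one_pos.trans_le (le_max_left _ _)) hΛ0) fun η hη hmod => ?_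
    rw [mul_assoc]
    exact modular_mul_le_one hq1 (hmain f hf η hη hmod)

/-- On the ball |b - b_B| is almost everywhere at most Λ p^(γβ), so monotonicity and homogeneity of
the norm suffice; no regularity of q enters. -/
theorem MemLipschitz.oscillation_lt_top (hn : 1 ≤ n) (hβ : 0 < β)
    (hb : LocallyIntegrable b (haar p n)) (h : MemLipschitz β b) {q : Qpn p n → ℝ}
    (hq : ∀ y, 0 ≤ q y) : oscillation β b q < ∞ := by
  obtain ⟨g, hg, hgb, hlip⟩ := h
  have hn0 : (n : ℝ) ≠ 0 := by positivity
  set Λ : ℝ≥0 := max 1 (lipNorm β g).toNNReal with hΛ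
  have hΛ0 : 0 < Λ := one_pos.trans_le (le_max_left _ _)
  have hlipΛ : lipNorm β g ≤ Λ := by
    rw [← ENNReal.coe_toNNReal hlip.ne]
    exact_mod_cast le_max_right _ _
  refine (iSup₂_le fun γ x => ?_).trans_lt (ENNReal.coe_lt_top (r := Λ))
  have hpow0 : (p : ℝ≥0∞) ^ (γ * β) ≠ 0 := (ENNReal.rpow_pos
    (pos_iff_ne_zero.2 (prime_ennreal_ne_zero p)) (prime_ennreal_ne_top p)).ne'
  have hpowt : (p : ℝ≥0∞) ^ (γ * β) ≠ ∞ :=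
    ENNReal.rpow_ne_top_of_ne_zero (prime_ennreal_ne_zero p) (prime_ennreal_ne_top p)
  have hV : (haar p n (pBall γ x)) ^ (β / n) = (p : ℝ≥0∞) ^ (γ * β) := by
    rw [haar_pBall, ← ENNReal.rpow_mul]
    congr 1
    field_simp
  rw [hV, ← ENNReal.div_eq_inv_mul]
  refine ENNReal.div_le_of_le_mul (ENNReal.div_le_of_le_mul ?_)
  set C : ℝ≥0 := Λ * ((p : ℝ≥0∞) ^ (γ * β)).toNNReal with hC
  have hC' : (C : ℝ≥0∞) = Λ * (p : ℝ≥0∞) ^ (γ * β) := by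
    rw [hC, ENNReal.coe_mul, ENNReal.coe_toNNReal hpowt]
  rw [← hC']
  refine luxNorm_le_mul_of_enorm_le hq
    (mul_pos hΛ0 (ENNReal.toNNReal_pos hpow0 hpowt)) ?_
  filter_upwards [hgb] with y hy
  by_cases hmem : y ∈ pBall γ x
  · rw [indicator_of_mem hmem, indicator_of_mem hmem, enorm_one, mul_one, hC']
    refine (enorm_sub_setAverage_le hb _ _ _).trans ((ballAverage_mono_ae ?_).trans_eq
      (ballAverage_const (Λ * (p : ℝ≥0∞) ^ (γ * β)) γ x))
    filter_upwards [ae_restrict_of_ae hgb, ae_restrict_mem (measurableSet_pBall γ x)] with z hz hzm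
    rw [← hy, ← hz]
    rw [← pBall_eq_of_mem hmem] at hzm
    exact (enorm_sub_le_of_mem_pBall hβ hzm).trans (mul_le_mul_left hlipΛ _)
  · rw [indicator_of_notMem hmem]
    simp

end Lipschitz

/-! ### Norms of indicator functions of balls -/

section ReferenceExponents

lemma modular_indicator_pBall {q : Qpn p n → ℝ} (hq : ∀ y, 0 < q y) (f : Qpn p n → ℝ) (γ : ℤ)
    (a : Qpn p n) (η : ℝ≥0) :
    modular q ((pBall γ a).indicator f) η =
      ∫⁻ y in pBall γ a, (‖f y‖ₑ / η) ^ q y ∂(haar p n) := by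
  rw [modular, ← lintegral_indicator (measurableSet_pBall γ a)]
  refine lintegral_congr fun y => ?_
  by_cases hy : y ∈ pBall γ a
  · rw [indicator_of_mem hy, indicator_of_mem hy]
  · rw [indicator_of_notMem hy, indicator_of_notMem hy, enorm_zero, ENNReal.zero_div,
      ENNReal.zero_rpow_of_pos (hq y)]

/-- The value η = |B|^(1/q₀) has bounded modular, and a constant multiple of it is then an
admissible competitor. -/
lemma exists_luxNorm_indicator_le {C : ℝ} (hC : 0 ≤ C) :
    ∃ K : ℝ≥0, ∀ (γ : ℤ) (a : Qpn p n) (q : Qpn p n → ℝ) (q₀ : ℝ), (∀ y, 1 ≤ q y) → 1 ≤ q₀ →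
      IsRefExponent C γ a q q₀ →
      luxNorm q ((pBall γ a).indicator fun _ => (1 : ℝ)) ≤ K * (p : ℝ≥0∞) ^ (n * γ / q₀) := by
  obtain ⟨K, hK⟩ := exists_lintegral_rpow_le_of_isRefExponent (p := p) (n := n) one_pos hC
  refine ⟨max 1 K, fun γ a q q₀ hq hq₀ href => ?_⟩
  have hpow0 : (p : ℝ≥0∞) ^ (n * γ / q₀) ≠ 0 := (ENNReal.rpow_pos
    (pos_iff_ne_zero.2 (prime_ennreal_ne_zero p)) (prime_ennreal_ne_top p)).ne'
  have hpowt : (p : ℝ≥0∞) ^ (n * γ / q₀) ≠ ∞ :=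
    ENNReal.rpow_ne_top_of_ne_zero (prime_ennreal_ne_zero p) (prime_ennreal_ne_top p)
  set η : ℝ≥0 := ((p : ℝ≥0∞) ^ (n * γ / q₀)).toNNReal with hη
  have hη' : (η : ℝ≥0∞) = (p : ℝ≥0∞) ^ (n * γ / q₀) := ENNReal.coe_toNNReal hpowt
  rw [← hη', ← ENNReal.coe_mul]
  refine luxNorm_le (mul_pos (one_pos.trans_le (le_max_left _ _))
    (ENNReal.toNNReal_pos hpow0 hpowt)) (modular_mul_le_one hq ?_)
  rw [modular_indicator_pBall fun y => one_pos.trans_le (hq y)]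
  refine le_trans (le_of_eq (lintegral_congr fun y => ?_)) (hK γ a q q₀ hq hq₀ href)
  rw [enorm_one, one_div, hη', ENNReal.rpow_neg]

/-- The Hölder inequality against the indicator function of a ball. -/
lemma exists_lintegral_pBall_le {s C : ℝ} (hs : 1 < s) (hC : 0 ≤ C) :
    ∃ K : ℝ≥0, 0 < K ∧ ∀ (γ : ℤ) (a : Qpn p n) (q : Qpn p n → ℝ) (q₀ : ℝ) (h : Qpn p n → ℝ≥0∞),
      Measurable q → (∀ y, s ≤ q y) → s ≤ q₀ → IsRefExponent C γ a q q₀ →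
      ∫⁻ y in pBall γ a, h y ^ q y ∂(haar p n) ≤ 1 →
      ∫⁻ y in pBall γ a, h y ∂(haar p n) ≤ K * (p : ℝ≥0∞) ^ (n * γ * (1 - 1 / q₀)) := by
  have hp0 := prime_ennreal_ne_zero p
  have hpt := prime_ennreal_ne_top p
  have hC' : 0 ≤ ((s - 1) ^ 2)⁻¹ * C := by positivity
  obtain ⟨K, hK⟩ := exists_lintegral_rpow_le_of_isRefExponent (p := p) (n := n) one_pos hC'
  refine ⟨1 + K, by positivity, fun γ a q q₀ h hqm hq hq₀ href hint => ?_⟩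
  have hone : ∀ t : ℝ, s ≤ t → 1 ≤ t.conjExponent := fun t ht =>
    ((Real.HolderConjugate.conjExponent (hs.trans_le ht)).symm.lt).le
  -- Up to constants this is the reciprocal of the conjugate norm of χ_B, so Young's inequality for
  -- h · τ integrates to a bounded quantity.
  set τ : ℝ≥0∞ := (p : ℝ≥0∞) ^ (-(n * γ / q₀.conjExponent)) with hτ
  have hτt : τ ≠ ∞ := ENNReal.rpow_ne_top_of_ne_zero hp0 hpt
  have hτ0 : τ ≠ 0 := (ENNReal.rpow_pos (pos_iff_ne_zero.2 hp0) hpt).ne'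
  have hτint := hK γ a (fun y => (q y).conjExponent) q₀.conjExponent (fun y => hone _ (hq y))
    (hone _ hq₀) (href.of_abs_sub_le (by positivity)
      fun y => abs_conjExponent_sub_le hs (hq y) hq₀)
  have hcm : Measurable fun y => (q y).conjExponent := by
    unfold Real.conjExponent
    exact hqm.div (hqm.sub_const 1)
  have h1 : τ * ∫⁻ y in pBall γ a, h y ∂(haar p n) ≤ 1 + K := by
    rw [← lintegral_const_mul' _ _ hτt]
    calc ∫⁻ y in pBall γ a, τ * h y ∂(haar p n)
        ≤ ∫⁻ y in pBall γ a, (h y ^ q y + τ ^ (q y).conjExponent) ∂(haar p n) := by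
          refine lintegral_mono fun y => ?_
          have hconj := Real.HolderConjugate.conjExponent (hs.trans_le (hq y))
          rw [mul_comm]
          refine (ENNReal.young_inequality (h y) τ hconj).trans (add_le_add ?_ ?_)
          · exact ENNReal.div_le_of_le_mul
              (le_mul_of_one_le_right' (by simpa using hs.le.trans (hq y)))
          · exact ENNReal.div_le_of_le_mul
              (le_mul_of_one_le_right' (by simpa using hone _ (hq y)))
      _ ≤ 1 + K := by
          rw [lintegral_add_right _ (measurable_const.pow hcm)]
          exact add_le_add hint hτint
  have h2 : (p : ℝ≥0∞) ^ (n * γ * (1 - 1 / q₀)) = τ⁻¹ := by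
    rw [hτ, ENNReal.rpow_neg, inv_inv, Real.conjExponent]
    congr 1
    have : q₀ ≠ 0 := by linarith
    have : q₀ - 1 ≠ 0 := by linarith
    field_simp
  rw [h2, ENNReal.coe_add, ENNReal.coe_one, ← div_eq_mul_inv,
    ENNReal.le_div_iff_mul_le (Or.inl hτ0) (Or.inl hτt), mul_comm]
  exact h1

/-- By duality: for every competitor η, the Hölder inequality applied to the constant 1/η on the
ball bounds η from below. -/
lemma exists_le_mul_luxNorm_indicator {s C : ℝ} (hs : 1 < s) (hC : 0 ≤ C) :
    ∃ K : ℝ≥0, ∀ (γ : ℤ) (a : Qpn p n) (q : Qpn p n → ℝ) (q₀ : ℝ), Measurable q →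
      (∀ y, s ≤ q y) → s ≤ q₀ → IsRefExponent C γ a q q₀ →
      (p : ℝ≥0∞) ^ (n * γ / q₀) ≤ K * luxNorm q ((pBall γ a).indicator fun _ => (1 : ℝ)) := by
  have hp0 := prime_ennreal_ne_zero p
  have hpt := prime_ennreal_ne_top p
  obtain ⟨K, hK0, hK⟩ := exists_lintegral_pBall_le (p := p) (n := n) hs hC
  refine ⟨K, fun γ a q q₀ hqm hq hq₀ href => ?_⟩
  have hK0' : (K : ℝ≥0∞) ≠ 0 := by exact_mod_cast hK0.ne'
  rw [luxNorm, ENNReal.mul_iInf_of_ne hK0' ENNReal.coe_ne_top]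
  refine le_iInf fun η => ?_
  rw [ENNReal.mul_iInf_of_ne hK0' ENNReal.coe_ne_top]
  refine le_iInf fun hη => ?_
  have hη0 : (η : ℝ≥0∞) ≠ 0 := by exact_mod_cast hη.1.ne'
  have hm := hη.2
  rw [modular_indicator_pBall fun y => by linarith [hq y]] at hm
  have h1 := hK γ a q q₀ _ hqm hq hq₀ href hm
  rw [setLIntegral_const, haar_pBall, enorm_one, one_div] at h1
  have h2 : (p : ℝ≥0∞) ^ ((n : ℝ) * γ) ≤ K * (p : ℝ≥0∞) ^ (n * γ * (1 - 1 / q₀)) * η := by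
    calc (p : ℝ≥0∞) ^ ((n : ℝ) * γ)
        = (η : ℝ≥0∞)⁻¹ * (p : ℝ≥0∞) ^ ((n : ℝ) * γ) * η := by
          rw [mul_right_comm, ENNReal.inv_mul_cancel hη0 ENNReal.coe_ne_top, one_mul]
      _ ≤ _ := mul_le_mul_left h1 _
  calc (p : ℝ≥0∞) ^ (n * γ / q₀)
      = (p : ℝ≥0∞) ^ (-(n * γ * (1 - 1 / q₀))) * (p : ℝ≥0∞) ^ ((n : ℝ) * γ) := by
        rw [← ENNReal.rpow_add _ _ hp0 hpt]
        congr 1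
        ring
    _ ≤ (p : ℝ≥0∞) ^ (-(n * γ * (1 - 1 / q₀))) *
          (K * (p : ℝ≥0∞) ^ (n * γ * (1 - 1 / q₀)) * η) := mul_le_mul_right h2 _
    _ = (p : ℝ≥0∞) ^ (-(n * γ * (1 - 1 / q₀))) * (p : ℝ≥0∞) ^ (n * γ * (1 - 1 / q₀)) *
          (K * η) := by ring
    _ = K * η := by
        rw [← ENNReal.rpow_add _ _ hp0 hpt, neg_add_cancel, ENNReal.rpow_zero, one_mul]

end ReferenceExponents

/-! ### From the commutator to mean oscillation -/

section Necessity

variable {β : ℝ} {b r q : Qpn p n → ℝ}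

/-- Reference exponents for both members of an admissible pair. -/
lemma AdmissiblePair.exists_isRefExponent (hn : 1 ≤ n) (hβ : 0 < β) (h : AdmissiblePair β r q) :
    ∃ s C : ℝ, 1 < s ∧ 0 ≤ C ∧ (∀ y, s ≤ r y) ∧ (∀ y, s ≤ q y) ∧ ∀ (γ : ℤ) (a : Qpn p n),
      ∃ r₀ q₀ : ℝ, s ≤ r₀ ∧ s ≤ q₀ ∧ 1 / r₀ = β / n + 1 / q₀ ∧
        IsRefExponent C γ a r r₀ ∧ IsRefExponent C γ a q q₀ := by
  have hexp := h.logHolder_r.isExponent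
  have hs := hexp.one_lt_essInf
  have hR := h.div_lt hn hβ
  have hα : 0 ≤ β / n := by positivity
  obtain ⟨C, hC, href⟩ := h.logHolder_r.exists_isRefExponent hn
  set s := essInf r (haar p n) with hsr
  set R := essSup r (haar p n) with hRr
  -- The same constant must serve r, with factor 1, and q, with the Lipschitz constant of the
  -- Sobolev exponent.
  set L := max 1 (sobolevExponent (β / n) R ^ 2) with hL
  have hs0 : 0 < s := by linarith
  have hL0 : 0 ≤ L := zero_le_one.trans (le_max_left _ _)
  refine ⟨s, L * C, hs, by positivity, hexp.essInf_le, fun y => ?_, fun γ a => ?_⟩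
  · rw [h.eq_sobolevExponent]
    exact (hexp.essInf_le y).trans
      (le_sobolevExponent hα hs0 (hexp.essInf_le y) (hexp.le_essSup y) hR)
  · obtain ⟨r₀, h1, h2, h3⟩ := href γ a
    refine ⟨r₀, sobolevExponent (β / n) r₀, h1, h1.trans (le_sobolevExponent hα hs0 h1 h2 hR), ?_,
      h3.of_abs_sub_le hL0 fun y => ?_, h3.of_abs_sub_le hL0 fun y => ?_⟩
    · rw [sobolevExponent, one_div, one_div, inv_inv]
      ring
    · exact le_mul_of_one_le_left (abs_nonneg _) (le_max_left _ _)
    · rw [h.eq_sobolevExponent]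
      refine (abs_sobolevExponent_sub_le hs.le (hexp.essInf_le y) (hexp.le_essSup y) h1 h2
        hR).trans ?_
      exact mul_le_mul_of_nonneg_right (le_max_right _ _) (abs_nonneg _)

lemma haar_pBall_rpow_div (hn : 1 ≤ n) (β : ℝ) (γ : ℤ) (a : Qpn p n) :
    (haar p n (pBall γ a)) ^ (β / n) = (p : ℝ≥0∞) ^ (γ * β) := by
  have hn0 : (n : ℝ) ≠ 0 := by positivity
  rw [haar_pBall, ← ENNReal.rpow_mul]
  congr 1
  field_simp

/-- The operator is tested on χ_B. Its norm in L^r is at most a constant times |B|^(1/r₀) =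
|B|^(β/n) |B|^(1/q₀), and the last factor is controlled by the norm of χ_B in L^q. -/
theorem CommutatorBounded.oscillation_lt_top (hn : 1 ≤ n) (hβ : 0 < β)
    (hb : LocallyIntegrable b (haar p n)) (hrq : AdmissiblePair β r q)
    (h : CommutatorBounded b r q) : oscillation β b q < ∞ := by
  have hp0 := prime_ennreal_ne_zero p
  have hpt := prime_ennreal_ne_top p
  have hn0 : (n : ℝ) ≠ 0 := by positivity
  obtain ⟨s, C, hs, hC, hsr, hsq, href⟩ := hrq.exists_isRefExponent hn hβ
  obtain ⟨A, hA⟩ := h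
  obtain ⟨K₁, hK₁⟩ := exists_luxNorm_indicator_le (p := p) (n := n) hC
  obtain ⟨K₂, hK₂⟩ := exists_le_mul_luxNorm_indicator (p := p) (n := n) hs hC
  refine (iSup₂_le fun γ x => ?_).trans_lt (ENNReal.coe_lt_top (r := A * K₁ * K₂))
  obtain ⟨r₀, q₀, hr₀, hq₀, hrel, hrefr, hrefq⟩ := href γ x
  rw [haar_pBall_rpow_div hn, ← ENNReal.div_eq_inv_mul]
  refine ENNReal.div_le_of_le_mul (ENNReal.div_le_of_le_mul ?_)
  have hr0 : ∀ y, 0 < r y := fun y => by linarith [hsr y]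
  have hmem : MemLvar r ((pBall γ x).indicator fun _ => (1 : ℝ)) := by
    refine ⟨(measurable_const.indicator (measurableSet_pBall γ x)).aestronglyMeasurable, 1,
      one_pos, ?_⟩
    rw [modular_indicator_pBall hr0]
    simp only [enorm_one, ENNReal.coe_one, div_one, ENNReal.one_rpow]
    rw [setLIntegral_const, one_mul]
    exact (haar_pBall_ne_top γ x).lt_top
  have h1 : luxNorm q ((pBall γ x).indicator fun y => b y - ⨍ z in pBall γ x, b z ∂(haar p n)) ≤
      (1 : ℝ≥0) * luxNorm q
        (maximalCommutator b ((pBall γ x).indicator fun _ => (1 : ℝ))) := by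
    refine luxNorm_le_mul_of_enorm_le (fun y => by linarith [hsq y]) one_pos
      (ae_of_all _ fun y => ?_)
    rw [ENNReal.coe_one, one_mul, enorm_eq_self]
    by_cases hy : y ∈ pBall γ x
    · rw [indicator_of_mem hy]
      -- The supremum runs over balls centred at y, and the ball of index γ about y is the given
      -- one.
      refine (enorm_sub_setAverage_le hb _ _ _).trans (le_iSup_of_le γ (le_of_eq ?_))
      rw [haar_inv_mul_lintegral_pBall, ballAverage, ballAverage, pBall_eq_of_mem hy]
      congr 1
      refine setLIntegral_congr_fun (measurableSet_pBall γ x) fun z hz => ?_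
      rw [indicator_of_mem hz, enorm_one, mul_one]
    · rw [indicator_of_notMem hy, enorm_zero]
      exact zero_le
  rw [ENNReal.coe_one, one_mul] at h1
  calc luxNorm q ((pBall γ x).indicator fun y => b y - ⨍ z in pBall γ x, b z ∂(haar p n))
      ≤ A * luxNorm r ((pBall γ x).indicator fun _ => (1 : ℝ)) := h1.trans (hA _ hmem).2
    _ ≤ A * (K₁ * (p : ℝ≥0∞) ^ (n * γ / r₀)) := by
        gcongr
        exact hK₁ γ x r r₀ (fun y => hs.le.trans (hsr y)) (hs.le.trans hr₀) hrefr
    _ = A * K₁ * (p : ℝ≥0∞) ^ (γ * β) * (p : ℝ≥0∞) ^ (n * γ / q₀) := by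
        have : n * γ / r₀ = γ * β + n * γ / q₀ := by
          rw [div_eq_mul_one_div (n * γ : ℝ) r₀, hrel]
          field_simp
        rw [this, ENNReal.rpow_add _ _ hp0 hpt]
        ring
    _ ≤ A * K₁ * (p : ℝ≥0∞) ^ (γ * β) *
          (K₂ * luxNorm q ((pBall γ x).indicator fun _ => (1 : ℝ))) := by
        gcongr
        exact hK₂ γ x q q₀ hrq.logHolder_q.isExponent.measurable hsq hq₀ hrefq
    _ = _ := by
        push_cast
        ring

/-- Finite oscillation in `L^{q(·)}` controls the mean oscillation. -/
lemma exists_ballAverage_sub_setAverage_le (hn : 1 ≤ n) (hβ : 0 < β) (hrq : AdmissiblePair β r q)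
    (h : oscillation β b q < ∞) :
    ∃ A : ℝ≥0, ∀ (γ : ℤ) (x : Qpn p n),
      ballAverage (fun y => ‖b y - ⨍ z in pBall γ x, b z ∂(haar p n)‖ₑ) γ x ≤
        A * (p : ℝ≥0∞) ^ (γ * β) := by
  have hp0 := prime_ennreal_ne_zero p
  have hpt := prime_ennreal_ne_top p
  have hpow0 : ∀ t : ℝ, (p : ℝ≥0∞) ^ t ≠ 0 := fun t =>
    (ENNReal.rpow_pos (pos_iff_ne_zero.2 hp0) hpt).ne'
  have hpowt : ∀ t : ℝ, (p : ℝ≥0∞) ^ t ≠ ∞ := fun t => ENNReal.rpow_ne_top_of_ne_zero hp0 hpt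
  obtain ⟨s, C, hs, hC, hsr, hsq, href⟩ := hrq.exists_isRefExponent hn hβ
  obtain ⟨K₁, hK₁⟩ := exists_luxNorm_indicator_le (p := p) (n := n) hC
  obtain ⟨K₂, -, hK₂⟩ := exists_lintegral_pBall_le (p := p) (n := n) hs hC
  set L := (oscillation β b q).toNNReal with hL
  have hL' : (L : ℝ≥0∞) = oscillation β b q := ENNReal.coe_toNNReal h.ne
  refine ⟨(L * K₁ + 1) * K₂, fun γ x => ?_⟩
  obtain ⟨r₀, q₀, -, hq₀, -, -, hrefq⟩ := href γ x
  set g := fun y => b y - ⨍ z in pBall γ x, b z ∂(haar p n) with hg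
  set N₂ := luxNorm q ((pBall γ x).indicator fun _ => (1 : ℝ)) with hN₂
  have hN₂le : N₂ ≤ K₁ * (p : ℝ≥0∞) ^ (n * γ / q₀) :=
    hK₁ γ x q q₀ (fun y => hs.le.trans (hsq y)) (hs.le.trans hq₀) hrefq
  have hN₁ : luxNorm q ((pBall γ x).indicator g) ≤ L * (p : ℝ≥0∞) ^ (γ * β) * N₂ := by
    have h1 : ((p : ℝ≥0∞) ^ (γ * β))⁻¹ * (luxNorm q ((pBall γ x).indicator g) / N₂) ≤ L := by
      rw [hL', ← haar_pBall_rpow_div hn β γ x]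
      exact le_iSup₂_of_le (f := fun (γ : ℤ) (x : Qpn p n) => ((haar p n (pBall γ x)) ^ (β / n))⁻¹ *
        (luxNorm q ((pBall γ x).indicator fun y => b y - ⨍ z in pBall γ x, b z ∂(haar p n)) /
          luxNorm q ((pBall γ x).indicator fun _ => (1 : ℝ)))) γ x le_rfl
    rw [← ENNReal.div_eq_inv_mul, ENNReal.div_le_iff (hpow0 _) (hpowt _)] at h1
    have hN₂t : N₂ ≠ ∞ :=
      (hN₂le.trans_lt (ENNReal.mul_lt_top ENNReal.coe_lt_top (hpowt _).lt_top)).ne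
    rwa [ENNReal.div_le_iff_le_mul (Or.inr (ENNReal.mul_ne_top ENNReal.coe_ne_top (hpowt _)))
      (Or.inl hN₂t)] at h1
  set E := (p : ℝ≥0∞) ^ (γ * β) * (p : ℝ≥0∞) ^ (n * γ / q₀) with hE
  have hE0 : E ≠ 0 := mul_ne_zero (hpow0 _) (hpow0 _)
  have hEt : E ≠ ∞ := ENNReal.mul_ne_top (hpowt _) (hpowt _)
  -- The extra 1 makes the inequality strict, so some η below the bound has modular at most one.
  have hlt : luxNorm q ((pBall γ x).indicator g) < (L * K₁ + 1) * E := by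
    calc luxNorm q ((pBall γ x).indicator g)
        ≤ L * (p : ℝ≥0∞) ^ (γ * β) * (K₁ * (p : ℝ≥0∞) ^ (n * γ / q₀)) :=
          hN₁.trans (mul_le_mul_right hN₂le _)
      _ = L * K₁ * E := by rw [hE]; ring
      _ < L * K₁ * E + E := ENNReal.lt_add_right
          (ENNReal.mul_ne_top (ENNReal.mul_ne_top (by simp) (by simp)) hEt) hE0
      _ = _ := by rw [add_mul, one_mul]
  obtain ⟨η, hη, hmod, hηlt⟩ := exists_modular_le_one_of_luxNorm_lt hlt
  have hη0 : (η : ℝ≥0∞) ≠ 0 := by exact_mod_cast hη.ne'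
  rw [modular_indicator_pBall fun y => by linarith [hsq y]] at hmod
  have h2 := hK₂ γ x q q₀ _ hrq.logHolder_q.isExponent.measurable hsq hq₀ hrefq hmod
  have h3 : ∫⁻ y in pBall γ x, ‖g y‖ₑ ∂(haar p n) =
      η * ∫⁻ y in pBall γ x, ‖g y‖ₑ / η ∂(haar p n) := by
    rw [← lintegral_const_mul' _ _ ENNReal.coe_ne_top]
    refine lintegral_congr fun y => ?_
    rw [ENNReal.mul_div_cancel hη0 ENNReal.coe_ne_top]
  calc ballAverage (fun y => ‖g y‖ₑ) γ x
      = (p : ℝ≥0∞) ^ (-(n * γ : ℝ)) * (η * ∫⁻ y in pBall γ x, ‖g y‖ₑ / η ∂(haar p n)) := by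
        rw [ballAverage, haar_pBall, ENNReal.rpow_neg, ← h3]
    _ ≤ (p : ℝ≥0∞) ^ (-(n * γ : ℝ)) *
          ((L * K₁ + 1) * E * (K₂ * (p : ℝ≥0∞) ^ (n * γ * (1 - 1 / q₀)))) :=
        mul_le_mul_right (mul_le_mul' hηlt.le h2) _
    _ = (L * K₁ + 1) * K₂ * ((p : ℝ≥0∞) ^ (-(n * γ : ℝ)) * E *
          (p : ℝ≥0∞) ^ (n * γ * (1 - 1 / q₀))) := by ring
    _ = _ := by
        rw [hE, ← ENNReal.rpow_add _ _ hp0 hpt, ← ENNReal.rpow_add _ _ hp0 hpt,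
          ← ENNReal.rpow_add _ _ hp0 hpt]
        push_cast
        congr 2
        ring

end Necessity

/-! ### Campanato's characterization -/

section Campanato

variable {β : ℝ} {b : Qpn p n → ℝ}

/-- The average over the subball of a nonnegative function is at most p^n times its average over the
ball, p^n being the ratio of measures. -/
lemma dist_setAverage_pBall_le (hb : LocallyIntegrable b (haar p n)) {A : ℝ≥0}
    (hA : ∀ (γ : ℤ) (x : Qpn p n),
      ballAverage (fun y => ‖b y - ⨍ z in pBall γ x, b z ∂(haar p n)‖ₑ) γ x ≤
        A * (p : ℝ≥0∞) ^ (γ * β)) (γ : ℤ) (x : Qpn p n) :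
    dist (⨍ z in pBall γ x, b z ∂(haar p n)) (⨍ z in pBall (γ - 1) x, b z ∂(haar p n)) ≤
      A * (p : ℝ) ^ n * (p : ℝ) ^ (γ * β) := by
  set c := ⨍ z in pBall γ x, b z ∂(haar p n) with hc
  have h1 : ‖c - ⨍ z in pBall (γ - 1) x, b z ∂(haar p n)‖ₑ ≤
      (p : ℝ≥0∞) ^ n * (A * (p : ℝ≥0∞) ^ (γ * β)) := by
    refine (enorm_sub_setAverage_le hb c (γ - 1) x).trans
      (le_trans ?_ (mul_le_mul_right (hA γ x) _))
    rw [ballAverage, ballAverage, ← mul_assoc]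
    refine mul_le_mul' (le_of_eq ?_) ?_
    · have h2 := haar_pBall_add (γ - 1) 1 x
      rw [sub_add_cancel, Int.cast_one, mul_one, ENNReal.rpow_natCast] at h2
      rw [h2, ENNReal.mul_inv (Or.inr (haar_pBall_ne_top _ _)) (Or.inr (haar_pBall_ne_zero _ _)),
        ← mul_assoc, ENNReal.mul_inv_cancel (pow_ne_zero _ (prime_ennreal_ne_zero p))
          (ENNReal.pow_ne_top (prime_ennreal_ne_top p)), one_mul]
    · simp_rw [← hc, ← edist_eq_enorm_sub, edist_comm c]
      exact lintegral_mono_set (pBall_mono (by omega) x)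
  rw [dist_eq_norm, ← toReal_enorm]
  have hfin : (p : ℝ≥0∞) ^ n * (A * (p : ℝ≥0∞) ^ (γ * β)) ≠ ∞ :=
    ENNReal.mul_ne_top (ENNReal.pow_ne_top (prime_ennreal_ne_top p))
      (ENNReal.mul_ne_top ENNReal.coe_ne_top
        (ENNReal.rpow_ne_top_of_ne_zero (prime_ennreal_ne_zero p) (prime_ennreal_ne_top p)))
  refine (ENNReal.toReal_mono hfin h1).trans (le_of_eq ?_)
  rw [ENNReal.toReal_mul, ENNReal.toReal_mul, ENNReal.toReal_pow, ← ENNReal.toReal_rpow,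
    ENNReal.toReal_natCast, ENNReal.coe_toReal]
  ring

lemma tendsto_comp_int_sub {u : ℤ → ℝ} {l : ℝ}
    (h : Tendsto (fun k : ℕ => u (-(k : ℤ))) atTop (𝓝 l)) (γ : ℤ) :
    Tendsto (fun k : ℕ => u (γ - k)) atTop (𝓝 l) := by
  have h1 : Tendsto (fun z : ℤ => u (-z)) atTop (𝓝 l) := by
    rw [← Nat.map_cast_int_atTop]
    exact h
  have h2 : Tendsto (fun k : ℕ => (k : ℤ) - γ) atTop atTop :=
    tendsto_atTop_add_const_right _ (-γ) tendsto_natCast_atTop_atTop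
  refine (h1.comp h2).congr fun k => ?_
  simp

/-- Campanato's characterization of Lipschitz functions. -/
theorem memLipschitz_of_ballAverage_le (hβ : 0 < β) (hb : LocallyIntegrable b (haar p n))
    {A : ℝ≥0} (hA : ∀ (γ : ℤ) (x : Qpn p n),
      ballAverage (fun y => ‖b y - ⨍ z in pBall γ x, b z ∂(haar p n)‖ₑ) γ x ≤
        A * (p : ℝ≥0∞) ^ (γ * β)) : MemLipschitz β b := by
  have hp := prime_real_pos p
  have hp1 := one_lt_prime_real p
  set u : Qpn p n → ℤ → ℝ := fun x γ => ⨍ z in pBall γ x, b z ∂(haar p n) with hu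
  set A' : ℝ := A * (p : ℝ) ^ n with hA'
  have hA'0 : 0 ≤ A' := by positivity
  set ρ : ℝ := (p : ℝ) ^ (-β) with hρ
  have hρ1 : ρ < 1 := Real.rpow_lt_one_of_one_lt_of_neg hp1 (by linarith)
  have hstep : ∀ x γ (k : ℕ), dist (u x (γ - k)) (u x (γ - (k + 1 : ℕ))) ≤
      A' * (p : ℝ) ^ (γ * β) * ρ ^ k := by
    intro x γ k
    have h1 := dist_setAverage_pBall_le hb hA (γ - k) x
    have h2 : γ - k - 1 = γ - (k + 1 : ℕ) := by push_cast; ring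
    rw [h2] at h1
    refine h1.trans (le_of_eq ?_)
    rw [hρ, ← Real.rpow_mul_natCast hp.le, mul_assoc A', ← Real.rpow_add hp, hA']
    congr 2
    push_cast
    ring
  -- Consecutive averages differ by a geometric sequence of ratio p^(-β) < 1, hence are Cauchy.
  have hlim : ∀ x, ∃ l, Tendsto (fun k : ℕ => u x (-(k : ℤ))) atTop (𝓝 l) := by
    intro x
    have := cauchySeq_of_le_geometric ρ _ hρ1 (hstep x 0)
    simp only [zero_sub] at this
    exact cauchySeq_tendsto_of_complete this
  choose f hf using hlim
  set S : ℝ := A' / (1 - ρ) with hS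
  have hS0 : 0 ≤ S := div_nonneg hA'0 (by linarith)
  have hclose : ∀ x γ, dist (u x γ) (f x) ≤ S * (p : ℝ) ^ (γ * β) := by
    intro x γ
    have h := dist_le_of_le_geometric_of_tendsto₀ ρ _ hρ1 (hstep x γ)
      (tendsto_comp_int_sub (hf x) γ)
    simp only [Nat.cast_zero, sub_zero] at h
    refine h.trans (le_of_eq ?_)
    rw [hS]
    ring
  have hHolder : ∀ x y, dist (f x) (f y) ≤ 2 * S * (p : ℝ) ^ β * dist x y ^ β := by
    intro x y
    rcases eq_or_ne x y with rfl | hxy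
    · rw [dist_self]; positivity
    -- At the scale of |x - y| rounded up, the balls about x and y coincide, so f(x) and f(y) are
    -- compared with the same average; rounding costs p^β.
    obtain ⟨γ, h1, h2⟩ := exists_mem_Ioc_zpow (dist_pos.2 hxy) hp1
    have hmem : y ∈ pBall (γ + 1) x := by
      rw [pBall, mem_closedBall, dist_comm]; exact h2
    have huv : u y (γ + 1) = u x (γ + 1) := by
      rw [hu]; simp only [pBall_eq_of_mem hmem]
    have hx := hclose x (γ + 1)
    have hy := hclose y (γ + 1)
    rw [huv] at hy
    have h3 : dist (f x) (f y) ≤ 2 * (S * (p : ℝ) ^ (((γ + 1 : ℤ) : ℝ) * β)) := by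
      have := dist_triangle_left (f x) (f y) (u x (γ + 1))
      linarith
    have h4 : (p : ℝ) ^ (((γ + 1 : ℤ) : ℝ) * β) ≤ (p : ℝ) ^ β * dist x y ^ β := by
      have h5 : (p : ℝ) ^ (((γ + 1 : ℤ) : ℝ) * β) = (p : ℝ) ^ β * ((p : ℝ) ^ γ) ^ β := by
        rw [← Real.rpow_intCast, ← Real.rpow_mul hp.le, ← Real.rpow_add hp]
        push_cast
        ring_nf
      rw [h5]
      gcongr
    calc dist (f x) (f y) ≤ 2 * S * (p : ℝ) ^ (((γ + 1 : ℤ) : ℝ) * β) := by linarith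
      _ ≤ 2 * S * ((p : ℝ) ^ β * dist x y ^ β) := by gcongr
      _ = _ := by ring
  set M : ℝ := 2 * S * (p : ℝ) ^ β with hM
  have hM0 : 0 ≤ M := by positivity
  have henorm : ∀ x y, ‖f x - f y‖ₑ ≤ ENNReal.ofReal M * ‖x - y‖ₑ ^ β := by
    intro x y
    rw [← ofReal_norm, ← ofReal_norm, ENNReal.ofReal_rpow_of_nonneg (norm_nonneg _) hβ.le,
      ← ENNReal.ofReal_mul hM0, ← dist_eq_norm, ← dist_eq_norm]
    exact ENNReal.ofReal_le_ofReal (hHolder x y)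
  have hcont : Continuous f := by
    have : HolderWith M.toNNReal β.toNNReal f := by
      intro x y
      rw [edist_eq_enorm_sub, edist_eq_enorm_sub, Real.coe_toNNReal β hβ.le]
      exact henorm x y
    exact this.continuous (by simpa using hβ)
  refine ⟨f, hcont.measurable, ?_, ?_⟩
  -- The limit of the averages over B_(-k)(x) is f(x) by construction and b(x) almost everywhere by
  -- Lebesgue differentiation.
  · filter_upwards [IsUnifLocDoublingMeasure.ae_tendsto_average (haar p n) hb 1] with x hx
    refine tendsto_nhds_unique (hf x) ?_
    refine hx (ι := ℕ) (l := atTop) (fun _ => x) (fun k => (p : ℝ) ^ (-(k : ℤ))) ?_ ?_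
    · refine tendsto_nhdsWithin_iff.2 ⟨?_, Eventually.of_forall fun k => zpow_pos hp _⟩
      simp_rw [zpow_neg, zpow_natCast, ← inv_pow]
      exact tendsto_pow_atTop_nhds_zero_of_lt_one (by positivity) (inv_lt_one_of_one_lt₀ hp1)
    · exact Eventually.of_forall fun k => mem_closedBall_self (by positivity)
  · refine (iSup₂_le fun x y => iSup_le fun hxy => ?_).trans_lt (ENNReal.ofReal_lt_top (r := M))
    exact ENNReal.div_le_of_le_mul (henorm x y)

end Campanato

/-! ### Existence of an admissible pair -/

section ConstantExponent

lemma isLogHolder_const {t : ℝ} (ht : 1 < t) : IsLogHolder (fun _ : Qpn p n => t) := by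
  have h0 : haar p n ≠ 0 := fun h => haar_pBall_ne_zero (p := p) (n := n) 0 0 (by rw [h]; rfl)
  refine ⟨⟨measurable_const, ⟨t, by rintro _ ⟨_, rfl⟩; exact le_rfl⟩, ?_, ?_, ?_⟩,
    ⟨0, fun γ x => ?_⟩, ⟨0, fun x y => ?_⟩⟩
  · rwa [essInf_const t h0]
  · intro x; rw [essInf_const t h0]
  · intro x; rw [essSup_const t h0]
  · rw [essInf_const t (haar_restrict_pBall_ne_zero γ x),
      essSup_const t (haar_restrict_pBall_ne_zero γ x), sub_self, mul_zero]
  · simp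

/-- A constant r strictly between 1 and n/β works; the interval is nonempty because β < 1 ≤ n. -/
lemma exists_admissiblePair (hn : 1 ≤ n) {β : ℝ} (hβ0 : 0 < β) (hβ1 : β < 1) :
    ∃ r q : Qpn p n → ℝ, AdmissiblePair β r q := by
  have h0 : haar p n ≠ 0 := fun h => haar_pBall_ne_zero (p := p) (n := n) 0 0 (by rw [h]; rfl)
  have hn1 : (1 : ℝ) ≤ n := by exact_mod_cast hn
  obtain ⟨t, ht1, ht2⟩ := exists_between (show 1 < n / β by rw [lt_div_iff₀ hβ0]; linarith)
  have ht0 : 0 < t := by linarith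
  have hR : β / n < 1 / t := by
    rw [lt_div_iff₀ hβ0] at ht2
    rw [div_lt_div_iff₀ (by linarith) ht0]
    linarith
  refine ⟨fun _ => t, fun _ => sobolevExponent (β / n) t, isLogHolder_const ht1,
    isLogHolder_const (ht1.trans_le
      (le_sobolevExponent (by positivity) ht0 le_rfl le_rfl hR)), ?_, fun _ => ?_⟩
  · rwa [essSup_const t h0]
  · rw [sobolevExponent, one_div, inv_inv]

end ConstantExponent

end PadicVar

theorem corollary4 (p : ℕ) [Fact p.Prime] (n : ℕ) (hn : 1 ≤ n) (β : ℝ) (hβ0 : 0 < β) (hβ1 : β < 1)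
    (b : PadicVar.Qpn p n → ℝ) (hb : LocallyIntegrable b (PadicVar.haar p n)) :
    List.TFAE [
      PadicVar.MemLipschitz β b,
      ∀ r q : PadicVar.Qpn p n → ℝ, PadicVar.AdmissiblePair β r q →
        PadicVar.CommutatorBounded b r q,
      ∃ r q : PadicVar.Qpn p n → ℝ, PadicVar.AdmissiblePair β r q ∧
        PadicVar.CommutatorBounded b r q,
      ∃ r q : PadicVar.Qpn p n → ℝ, PadicVar.AdmissiblePair β r q ∧
        PadicVar.oscillation β b q < ∞,
      ∀ r q : PadicVar.Qpn p n → ℝ, PadicVar.AdmissiblePair β r q →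
        PadicVar.oscillation β b q < ∞] := by
  obtain ⟨r₁, q₁, h₁⟩ := PadicVar.exists_admissiblePair (p := p) hn hβ0 hβ1
  tfae_have 1 → 2 := fun h r q hrq => h.commutatorBounded hn hβ0 hb hrq
  tfae_have 2 → 3 := fun h => ⟨r₁, q₁, h₁, h r₁ q₁ h₁⟩
  tfae_have 3 → 4 := fun ⟨r, q, hrq, h⟩ => ⟨r, q, hrq, h.oscillation_lt_top hn hβ0 hb hrq⟩
  tfae_have 4 → 1 := fun ⟨r, q, hrq, h⟩ => by
    obtain ⟨A, hA⟩ := PadicVar.exists_ballAverage_sub_setAverage_le hn hβ0 hrq h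
    exact PadicVar.memLipschitz_of_ballAverage_le hβ0 hb hA
  tfae_have 1 → 5 := fun h r q hrq => h.oscillation_lt_top hn hβ0 hb fun y =>
    zero_le_one.trans (hrq.logHolder_q.isExponent.one_le y)
  tfae_have 5 → 4 := fun h => ⟨r₁, q₁, h₁, h r₁ q₁ h₁⟩
  tfae_finish
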